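/- For a finite poset $P$ and $k\ge 0$ let $c_k(P)$ be the maximal cardinality of a union of $k$ chains of $P$, let $\lambda_k(P)=c_k(P)-c_{k-1}(P)$ for $k\ge1$, and let $\lambda(P)$ be the Young diagram (English convention, with rows numbered downwards and columns numbered from left to right) whose $k$-th row has $\lambda_k(P)$ boxes. An element of $P$ is called extremal if it is maximal or minimal. (i) Let $P$ be a finite poset, let $p_1\neq p_2$ be extremal elements of $P$ with $\lambda(P-\{p_1\})=\lambda(P-\{p_2\})$, and put $\lambda=\lambda(P)$. Then there are uniquely determined distinct boxes $A,B$ of $\lambda$ such that $$\lambda(P-\{p_1\})=\lambda(P-\{p_2\})=\lambda-\{B\},\qquad \lambda(P-\{p_1,p_2\})=\lambda-\{A,B\}. \qquad (*)$$ If $p_1$ and $p_2$ are both maximal or both minimal, then $A$ lies in the column of $B$ or in a column to the right of it. If one of $p_1,p_2$ is maximal and the other is minimal, then $A$ lies in the column of $B$ or in the column immediately to the left of it. (ii) The result is sharp. Let $\lambda$ be a Young diagram and let $A\neq B$ be boxes of $\lambda$ such that $\lambda-\{B\}$ and $\lambda-\{A,B\}$ are Young diagrams. If $A$ lies in the column of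 $B$ or in a column to the right of it, then there are a finite poset $P$ with $\lambda(P)=\lambda$ and two maximal elements $p_1,p_2$ of $P$ satisfying $(*)$; there are also a finite poset $P$ with $\lambda(P)=\lambda$ and two minimal elements $p_1,p_2$ of $P$ satisfying $(*)$. If $A$ lies in the column of $B$ or in the column immediately to the left of it, then there are a finite poset $P$ with $\lambda(P)=\lambda$, a maximal element $p_1$ and a minimal element $p_2$ of $P$ satisfying $(*)$. -/

import Mathlib

universe u

namespace GreeneShape

/-- `c_k(S)`: the maximal cardinality of a union of `k` chains of the subposet `S` of `P`
(chains may be empty and may overlap). For finite `P` the set below is nonempty and bounded,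
so the supremum is a maximum. -/
noncomputable def maxChainUnion {P : Type u} [PartialOrder P] (S : Set P) (k : ℕ) : ℕ :=
  sSup {m : ℕ | ∃ C : Fin k → Set P,
    (∀ i, IsChain (· ≤ ·) (C i) ∧ C i ⊆ S) ∧ (⋃ i, C i).ncard = m}

/-- `λ_{i+1}(S) = c_{i+1}(S) - c_i(S)`: the length of the `i`-th row, rows numbered from `0`. -/
noncomputable def rowLength {P : Type u} [PartialOrder P] (S : Set P) (i : ℕ) : ℕ :=
  maxChainUnion S (i + 1) - maxChainUnion S i

/-- The shape `λ(S)` of the subposet `S` of a finite poset, as its set of boxes. A box is a pair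
`(row, column)`, numbered from `0`, as for the cells of a `YoungDiagram`. -/
def shape {P : Type u} [PartialOrder P] (S : Set P) : Set (ℕ × ℕ) :=
  {b | b.2 < rowLength S b.1}

/-- With `λ = λ(P)`, the boxes `A`, `B` are two distinct boxes of `λ` with
`λ(P - {p₁}) = λ(P - {p₂}) = λ - {B}` and `λ(P - {p₁, p₂}) = λ - {A, B}`. -/
def RemovedBoxes {P : Type u} [PartialOrder P] (p₁ p₂ : P) (A B : ℕ × ℕ) : Prop :=
  A ∈ shape (Set.univ : Set P) ∧ B ∈ shape (Set.univ : Set P) ∧ A ≠ B ∧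
  shape (Set.univ \ {p₁}) = shape (Set.univ : Set P) \ {B} ∧
  shape (Set.univ \ {p₂}) = shape (Set.univ : Set P) \ {B} ∧
  shape (Set.univ \ {p₁, p₂}) = shape (Set.univ : Set P) \ {A, B}

end GreeneShape

/-! A family of k disjoint chains is encoded as a matching on two copies of P: chain steps are edges
x < y, uncovered elements are loops. It has |P| - k edges, so c_k becomes an optimisation over
matchings. Concavity of c_k follows by rebalancing two matchings, and f_S(t), the number of boxes
from column t on (`boxesFrom`), is the Legendre transform max_k (c_k(S) - t k).

The engine is the exchange along an alternating path (`exists_exchange`, `Admissible.exchange`). A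
maximal element is a lower end only in its own loop, a minimal one an upper end only in its own
loop, so the two ends of the path control which extremal elements change sides. Exchanging optimal
matchings gives inequalities between f_P, f_{P-p}, f_{P-q} and f_{P-p-q}: the loss f_S - f_{S-p}
weakly decreases in t, so p costs one box; f is submodular for two maximal elements, supermodular
for a maximal and a minimal one, and in the mixed case a bound relating t and t + 1 also holds.
Evaluated near the columns of A and B, these give the column restrictions; duality handles minimal
elements.

For sharpness, rows of μ become chains, with the first boxes of two rows tied together when two
elements of the same kind are wanted. Shapes are certified by relabelling the remaining elements by
boxes so that rows are chains and columns antichains. -/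

namespace GreeneShape

/-! ### Bipartite matchings: rebalancing and alternating paths -/

section Exchange

variable {α β : Type*}

/-- A multiset of edges of a bipartite graph that is a matching. -/
def IsMatching (M : Multiset (α × β)) : Prop :=
  (M.map Prod.fst).Nodup ∧ (M.map Prod.snd).Nodup

theorem isMatching_cons {e : α × β} {M : Multiset (α × β)} :
    IsMatching (e ::ₘ M) ↔
      e.1 ∉ M.map Prod.fst ∧ e.2 ∉ M.map Prod.snd ∧ IsMatching M := by
  simp only [IsMatching, Multiset.map_cons, Multiset.nodup_cons]
  tauto

theorem IsMatching.nodup {M : Multiset (α × β)} (h : IsMatching M) : M.Nodup :=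
  Multiset.Nodup.of_map _ h.1

theorem IsMatching.snd_eq {M : Multiset (α × β)} (h : IsMatching M) {x : α} {y y' : β}
    (h₁ : (x, y) ∈ M) (h₂ : (x, y') ∈ M) : y = y' :=
  congrArg Prod.snd (Multiset.inj_on_of_nodup_map h.1 _ h₁ _ h₂ rfl)

theorem IsMatching.fst_eq {M : Multiset (α × β)} (h : IsMatching M) {x x' : α} {y : β}
    (h₁ : (x, y) ∈ M) (h₂ : (x', y) ∈ M) : x = x' :=
  congrArg Prod.fst (Multiset.inj_on_of_nodup_map h.2 _ h₁ _ h₂ rfl)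

/-- An edge common to two matchings is common to any two matchings with the same sum. -/
theorem IsMatching.mem_of_add_eq {M M' N N' : Multiset (α × β)} (hN : IsMatching N)
    (hN' : IsMatching N') (h : N + N' = M + M') {e : α × β} (he : e ∈ M) (he' : e ∈ M') :
    e ∈ N ∧ e ∈ N' := by
  classical
  have h₁ := Multiset.one_le_count_iff_mem.2 he
  have h₂ := Multiset.one_le_count_iff_mem.2 he'
  have h₃ := Multiset.nodup_iff_count_le_one.1 hN.nodup e
  have h₄ := Multiset.nodup_iff_count_le_one.1 hN'.nodup e
  have h₅ := congrArg (Multiset.count e) h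
  rw [Multiset.count_add, Multiset.count_add] at h₅
  constructor <;> refine Multiset.one_le_count_iff_mem.1 ?_ <;> omega

theorem notMem_map_of_add_eq {γ : Type*} {M M' N N' : Multiset (α × β)} (f : α × β → γ)
    (h : N + N' = M + M') {y : γ} (hM : y ∉ M.map f) (hM' : y ∉ M'.map f) :
    y ∉ N.map f ∧ y ∉ N'.map f := by
  have h' := congrArg (Multiset.map f) h
  rw [Multiset.map_add, Multiset.map_add] at h'
  have : y ∉ N.map f + N'.map f := by
    rw [h', Multiset.mem_add]; tauto
  rw [Multiset.mem_add] at this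
  tauto

/-- Two matchings of different sizes can be rebalanced by one edge. -/
theorem exists_rebalanced_matchings (M M' : Multiset (α × β)) (hM : IsMatching M)
    (hM' : IsMatching M') (hlt : M.card < M'.card) :
    ∃ N N', IsMatching N ∧ IsMatching N' ∧ N + N' = M + M' ∧ N.card = M.card + 1 := by
  classical
  induction hn : M.card generalizing M M' with
  | zero =>
    obtain rfl := Multiset.card_eq_zero.1 hn
    obtain ⟨e, he⟩ := Multiset.card_pos_iff_exists_mem.1 (by omega : 0 < M'.card)
    obtain ⟨M₁, rfl⟩ := Multiset.exists_cons_of_mem he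
    refine ⟨{e}, M₁, by simp [IsMatching], (isMatching_cons.1 hM').2.2, ?_, by simp⟩
    simp
  | succ n ih =>
    obtain ⟨u, hu, hu'⟩ : ∃ u ∈ M'.map Prod.fst, u ∉ M.map Prod.fst := by
      by_contra! hc
      have := Multiset.card_le_card ((Multiset.le_iff_subset hM'.1).2 hc)
      simp only [Multiset.card_map] at this
      omega
    obtain ⟨⟨u, y⟩, he, rfl⟩ := Multiset.mem_map.1 hu
    obtain ⟨M₁', rfl⟩ := Multiset.exists_cons_of_mem he
    obtain ⟨hu₁, hy₁, hM₁'⟩ := isMatching_cons.1 hM'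
    by_cases hy : y ∈ M.map Prod.snd
    · obtain ⟨⟨v, y'⟩, hf, rfl⟩ := Multiset.mem_map.1 hy
      obtain ⟨M₁, rfl⟩ := Multiset.exists_cons_of_mem hf
      obtain ⟨hv, hy₂, hM₁⟩ := isMatching_cons.1 hM
      simp only [Multiset.card_cons] at hlt hn
      dsimp only at *
      obtain ⟨N, N', hN, hN', hs, hc⟩ := ih M₁ M₁' hM₁ hM₁' (by omega) (by omega)
      have hu₂ : u ∉ M₁.map Prod.fst := by
        rw [Multiset.map_cons, Multiset.mem_cons, not_or] at hu'
        exact hu'.2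
      obtain ⟨hu₃, hu₄⟩ := notMem_map_of_add_eq Prod.fst hs hu₂ hu₁
      obtain ⟨hy₃, hy₄⟩ := notMem_map_of_add_eq Prod.snd hs hy₂ hy₁
      -- `v` is a lower end at most once in `M₁ + M₁'`, so `N` or `N'` misses it. That one takes
      -- back the edge at `v`, the other the edge at `u`.
      have hv' : v ∉ N.map Prod.fst ∨ v ∉ N'.map Prod.fst := by
        have h₅ := congrArg (fun X => Multiset.count v (Multiset.map Prod.fst X)) hs
        simp only [Multiset.map_add, Multiset.count_add] at h₅
        rw [Multiset.count_eq_zero_of_notMem hv] at h₅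
        have h₆ := Multiset.nodup_iff_count_le_one.1 hM₁'.1 v
        rw [← Multiset.count_eq_zero, ← Multiset.count_eq_zero]
        omega
      rcases hv' with hv' | hv'
      · refine ⟨(v, y') ::ₘ N, (u, y') ::ₘ N', isMatching_cons.2 ⟨hv', hy₃, hN⟩,
          isMatching_cons.2 ⟨hu₄, hy₄, hN'⟩, ?_, by simp; omega⟩
        simp only [← Multiset.singleton_add] at hs ⊢
        rw [add_add_add_comm, hs, add_add_add_comm]
      · refine ⟨(u, y') ::ₘ N, (v, y') ::ₘ N', isMatching_cons.2 ⟨hu₃, hy₃, hN⟩,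
          isMatching_cons.2 ⟨hv', hy₄, hN'⟩, ?_, by simp; omega⟩
        simp only [← Multiset.singleton_add] at hs ⊢
        rw [add_add_add_comm, hs, add_comm {(u, y')}, add_add_add_comm]
    · refine ⟨(u, y) ::ₘ M, M₁', isMatching_cons.2 ⟨hu', hy, hM⟩, hM₁', ?_, by simp; omega⟩
      simp

/-- Exchange along the alternating path that starts in a left vertex `u` covered by `M'` only.
The path ends in a right vertex covered by `M'` only or in a left vertex covered by `M` only. -/
theorem exists_exchange (M M' : Multiset (α × β)) (hM : IsMatching M) (hM' : IsMatching M')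
    (u : α) (hu : u ∈ M'.map Prod.fst) (hu' : u ∉ M.map Prod.fst) :
    ∃ N N', IsMatching N ∧ IsMatching N' ∧ N + N' = M + M' ∧
      u ∈ N.map Prod.fst ∧ u ∉ N'.map Prod.fst ∧
      ((∃ w, N.map Prod.fst = u ::ₘ M.map Prod.fst ∧ u ::ₘ N'.map Prod.fst = M'.map Prod.fst ∧
          N.map Prod.snd = w ::ₘ M.map Prod.snd ∧ w ::ₘ N'.map Prod.snd = M'.map Prod.snd) ∨
        (∃ v, v ::ₘ N.map Prod.fst = u ::ₘ M.map Prod.fst ∧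
          u ::ₘ N'.map Prod.fst = v ::ₘ M'.map Prod.fst ∧
          N.map Prod.snd = M.map Prod.snd ∧ N'.map Prod.snd = M'.map Prod.snd)) := by
  classical
  induction hn : M.card generalizing M M' u with
  | zero =>
    obtain rfl := Multiset.card_eq_zero.1 hn
    obtain ⟨⟨u, y⟩, he, rfl⟩ := Multiset.mem_map.1 hu
    obtain ⟨M₁', rfl⟩ := Multiset.exists_cons_of_mem he
    refine ⟨{(u, y)}, M₁', by simp [IsMatching], (isMatching_cons.1 hM').2.2, by simp,
      by simp, (isMatching_cons.1 hM').1, Or.inl ⟨y, by simp⟩⟩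
  | succ n ih =>
    obtain ⟨⟨u, y⟩, he, rfl⟩ := Multiset.mem_map.1 hu
    obtain ⟨M₁', rfl⟩ := Multiset.exists_cons_of_mem he
    obtain ⟨hu₁, hy₁, hM₁'⟩ := isMatching_cons.1 hM'
    by_cases hy : y ∈ M.map Prod.snd
    · obtain ⟨⟨v, y'⟩, hf, rfl⟩ := Multiset.mem_map.1 hy
      obtain ⟨M₁, rfl⟩ := Multiset.exists_cons_of_mem hf
      obtain ⟨hv, hy₂, hM₁⟩ := isMatching_cons.1 hM
      simp only [Multiset.card_cons] at hn
      simp only [Multiset.map_cons] at *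
      have huv : u ≠ v := fun h => hu' (by simp [h])
      have hu₂ : u ∉ M₁.map Prod.fst := fun h => hu' (Multiset.mem_cons_of_mem h)
      -- With the first two edges of the path removed, the path either goes on from `v`, by
      -- induction, or ends there.
      by_cases hv' : v ∈ M₁'.map Prod.fst
      · obtain ⟨N, N', hN, hN', hs, -, hv₄, hc⟩ := ih M₁ M₁' hM₁ hM₁' v hv' hv (by omega)
        obtain ⟨hu₃, hu₄⟩ := notMem_map_of_add_eq Prod.fst hs hu₂ hu₁
        obtain ⟨hy₃, hy₄⟩ := notMem_map_of_add_eq Prod.snd hs hy₂ hy₁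
        refine ⟨(u, y') ::ₘ N, (v, y') ::ₘ N', isMatching_cons.2 ⟨hu₃, hy₃, hN⟩,
          isMatching_cons.2 ⟨hv₄, hy₄, hN'⟩, ?_, by simp, ?_, ?_⟩
        · simp only [← Multiset.singleton_add] at hs ⊢
          rw [add_add_add_comm, hs, add_comm {(u, y')}, add_add_add_comm]
        · rw [Multiset.map_cons, Multiset.mem_cons]
          exact not_or.2 ⟨huv, hu₄⟩
        · simp only [Multiset.map_cons]
          rcases hc with ⟨w, h₁, h₂, h₃, h₄⟩ | ⟨w, h₁, h₂, h₃, h₄⟩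
          · refine Or.inl ⟨w, by rw [h₁], by rw [h₂], ?_, ?_⟩
            · rw [h₃, Multiset.cons_swap]
            · rw [← h₄, Multiset.cons_swap]
          · refine Or.inr ⟨w, ?_, ?_, by rw [h₃], by rw [h₄]⟩
            · rw [Multiset.cons_swap, h₁]
            · rw [h₂, Multiset.cons_swap]
      · refine ⟨(u, y') ::ₘ M₁, (v, y') ::ₘ M₁', isMatching_cons.2 ⟨hu₂, hy₂, hM₁⟩,
          isMatching_cons.2 ⟨hv', hy₁, hM₁'⟩, ?_, by simp, ?_, Or.inr ⟨v, ?_⟩⟩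
        · simp only [← Multiset.singleton_add]
          rw [add_add_add_comm, add_comm {(u, y')}, add_add_add_comm]
        · rw [Multiset.map_cons, Multiset.mem_cons]
          exact not_or.2 ⟨huv, hu₁⟩
        · simp only [Multiset.map_cons]
          exact ⟨Multiset.cons_swap _ _ _, Multiset.cons_swap _ _ _, trivial, trivial⟩
    · refine ⟨(u, y) ::ₘ M, M₁', isMatching_cons.2 ⟨hu', hy, hM⟩, hM₁', by simp,
        by simp, hu₁, Or.inl ⟨y, by simp⟩⟩

end Exchange

/-! ### Counting loops -/

section Loops

variable {P : Type*}

open Classical in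
/-- The number of loops of a multiset of edges. -/
noncomputable def loopCount (M : Multiset (P × P)) : ℕ := M.countP fun e => e.1 = e.2

theorem loopCount_add (M N : Multiset (P × P)) :
    loopCount (M + N) = loopCount M + loopCount N := by
  classical
  exact Multiset.countP_add _ _ _

theorem loopCount_eq_ncard [Finite P] {M : Multiset (P × P)} (hM : IsMatching M) :
    loopCount M = {x : P | (x, x) ∈ M}.ncard := by
  classical
  have := Fintype.ofFinite P
  rw [loopCount, Multiset.countP_eq_card_filter]
  have h : {x : P | (x, x) ∈ M} =
      (((M.filter fun e => e.1 = e.2).map Prod.fst).toFinset : Set P) := by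
    ext x
    simp only [Set.mem_ofPred_eq, Finset.mem_coe, Multiset.mem_toFinset, Multiset.mem_map,
      Multiset.mem_filter, Prod.exists, exists_and_right, exists_eq_right]
    constructor
    · intro h
      exact ⟨x, h, rfl⟩
    · rintro ⟨y, h, rfl⟩
      exact h
  rw [h, Set.ncard_coe_finset, Multiset.toFinset_card_of_nodup, Multiset.card_map]
  exact Multiset.nodup_of_le (Multiset.map_le_map (Multiset.filter_le _ _)) hM.1

theorem loopCount_add_ncard [Finite P] {M : Multiset (P × P)} (hM : IsMatching M) :
    loopCount M + {x : P | (x, x) ∉ M}.ncard = Nat.card P := by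
  rw [loopCount_eq_ncard hM]
  exact Set.ncard_add_ncard_compl _

theorem IsMatching.card_le [Finite P] {M : Multiset (P × P)} (hM : IsMatching M) :
    M.card ≤ Nat.card P := by
  classical
  have := Fintype.ofFinite P
  rw [← Multiset.card_map Prod.fst M, Nat.card_eq_fintype_card,
    ← Multiset.toFinset_card_of_nodup hM.1]
  exact Finset.card_le_univ _

end Loops

/-! ### Chain families as matchings -/

section Chains

variable {P : Type u} [PartialOrder P]

theorem ncard_le_maxChainUnion [Finite P] {S : Set P} {k : ℕ} {C : Fin k → Set P}
    (hC : ∀ i, IsChain (· ≤ ·) (C i) ∧ C i ⊆ S) :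
    (⋃ i, C i).ncard ≤ maxChainUnion S k := by
  refine le_csSup ⟨Nat.card P, ?_⟩ ⟨C, hC, rfl⟩
  rintro m ⟨C, -, rfl⟩
  rw [← Set.ncard_univ]
  exact Set.ncard_le_ncard (Set.subset_univ _)

theorem exists_chains [Finite P] (S : Set P) (k : ℕ) :
    ∃ C : Fin k → Set P, (∀ i, IsChain (· ≤ ·) (C i) ∧ C i ⊆ S) ∧
      (⋃ i, C i).ncard = maxChainUnion S k := by
  refine Nat.sSup_mem (s := {m : ℕ | ∃ C : Fin k → Set P,
    (∀ i, IsChain (· ≤ ·) (C i) ∧ C i ⊆ S) ∧ (⋃ i, C i).ncard = m}) ⟨_, fun _ => ∅,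
    fun _ => ⟨Set.pairwise_empty _, Set.empty_subset _⟩, rfl⟩ ⟨Nat.card P, ?_⟩
  rintro m ⟨C, -, rfl⟩
  rw [← Set.ncard_univ]
  exact Set.ncard_le_ncard (Set.subset_univ _)

/-- A matching of the elements of `P`, as lower and as upper ends of edges `x ≤ y`, that contains
the loops of all elements outside `S`. Such a matching encodes a family of disjoint chains of `S`:
the loops are the elements outside the chains, the other edges are the steps of the chains. -/
structure Admissible (S : Set P) (M : Multiset (P × P)) : Prop where
  isMatching : IsMatching M
  le : ∀ e ∈ M, e.1 ≤ e.2
  loop_mem : ∀ p ∉ S, (p, p) ∈ M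

/-- Each covered element is assigned to one chain containing it. Edges join consecutive elements of
a class; only the top of a nonempty class is no lower end, which happens at most k times. -/
theorem exists_admissible_of_chains [Finite P] {S : Set P} {k : ℕ} {C : Fin k → Set P}
    (hC : ∀ i, IsChain (· ≤ ·) (C i) ∧ C i ⊆ S) :
    ∃ M, Admissible S M ∧ Nat.card P ≤ M.card + k ∧
      loopCount M + (⋃ i, C i).ncard = Nat.card P := by
  classical
  have := Fintype.ofFinite P
  set U := ⋃ i, C i with hU
  have hUS : U ⊆ S := Set.iUnion_subset fun i => (hC i).2
  -- The choice of `f` makes overlapping chains disjoint; outside `U` its value is irrelevant.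
  obtain ⟨f, hf⟩ : ∃ f : P → ℕ, ∀ x ∈ U, ∃ i : Fin k, f x = i ∧ x ∈ C i := by
    have : ∀ x, ∃ m : ℕ, x ∈ U → ∃ i : Fin k, m = i ∧ x ∈ C i := by
      intro x
      by_cases hx : x ∈ U
      · obtain ⟨i, hi⟩ := Set.mem_iUnion.1 hx
        exact ⟨i, fun _ => ⟨i, rfl, hi⟩⟩
      · exact ⟨0, fun h => absurd h hx⟩
    choose f hf using this
    exact ⟨f, hf⟩
  have hcomp : ∀ x ∈ U, ∀ y ∈ U, f x = f y → x ≤ y ∨ y ≤ x := by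
    intro x hx y hy hxy
    obtain ⟨i, hi, hxi⟩ := hf x hx
    obtain ⟨j, hj, hyj⟩ := hf y hy
    have : i = j := Fin.ext (by omega)
    subst this
    exact (hC i).1.total hxi hyj
  let E : P × P → Prop := fun e => (e.1 = e.2 ∧ e.1 ∉ U) ∨
    (e.1 ∈ U ∧ e.2 ∈ U ∧ f e.1 = f e.2 ∧ e.1 < e.2 ∧ ∀ z ∈ U, f z = f e.1 → e.1 < z → e.2 ≤ z)
  let F : Finset (P × P) := Finset.univ.filter E
  have hF : ∀ e, e ∈ F ↔ E e := fun e => by simp [F]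
  have hfst : Set.InjOn Prod.fst (F : Set (P × P)) := by
    rintro ⟨x, y⟩ h₁ ⟨x', y'⟩ h₂ rfl
    rw [Finset.mem_coe, hF] at h₁ h₂
    rcases h₁ with ⟨h, h'⟩ | ⟨h, hy, hfy, hlt, hmin⟩ <;>
      rcases h₂ with ⟨k, k'⟩ | ⟨k, ky, kfy, klt, kmin⟩ <;> dsimp only at *
    · rw [← h, ← k]
    · exact absurd k h'
    · exact absurd h k'
    · rw [le_antisymm (hmin _ ky kfy.symm klt) (kmin _ hy hfy.symm hlt)]
  have hsnd : Set.InjOn Prod.snd (F : Set (P × P)) := by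
    rintro ⟨x, y⟩ h₁ ⟨x', y'⟩ h₂ (rfl : y = y')
    rw [Finset.mem_coe, hF] at h₁ h₂
    rcases h₁ with ⟨h, h'⟩ | ⟨h, hy, hfy, hlt, hmin⟩ <;>
      rcases h₂ with ⟨k, k'⟩ | ⟨k, ky, kfy, klt, kmin⟩ <;> dsimp only at *
    · rw [h, k]
    · exact absurd (h ▸ ky) h'
    · exact absurd (k ▸ hy) k'
    · rcases hcomp x h x' k (hfy.trans kfy.symm) with hle | hle
      · rcases hle.eq_or_lt with rfl | hl
        · rfl
        · exact absurd (hmin _ k (kfy.trans hfy.symm) hl) (not_le_of_gt klt)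
      · rcases hle.eq_or_lt with rfl | hl
        · rfl
        · exact absurd (kmin _ h (hfy.trans kfy.symm) hl) (not_le_of_gt hlt)
  have hmatch : IsMatching F.val :=
    ⟨Finset.nodup_map_iff_injOn.2 hfst, Finset.nodup_map_iff_injOn.2 hsnd⟩
  have hloop : ∀ x, (x, x) ∈ F ↔ x ∉ U := fun x => by
    rw [hF]
    simp [E]
  refine ⟨F.val, ⟨hmatch, ?_, ?_⟩, ?_, ?_⟩
  · intro e he
    rcases (hF e).1 he with ⟨h, -⟩ | ⟨-, -, -, h, -⟩
    exacts [h.le, h.le]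
  · exact fun p hp => (hloop p).2 fun h => hp (hUS h)
  · set T : Finset P := Finset.univ \ F.image Prod.fst with hT
    have hTU : ∀ x ∈ T, x ∈ U := by
      intro x hx
      by_contra hxU
      simp only [hT, Finset.mem_sdiff, Finset.mem_univ, true_and, Finset.mem_image, not_exists,
        not_and] at hx
      exact hx (x, x) ((hloop x).2 hxU) rfl
    have hTmax : ∀ x ∈ T, ∀ y ∈ U, f y = f x → ¬ x < y := by
      intro x hx y hy hfy hxy
      obtain ⟨m, hm⟩ := Finset.exists_minimal
        (s := Finset.univ.filter fun z => z ∈ U ∧ f z = f x ∧ x < z) ⟨y, by simp [hy, hfy, hxy]⟩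
      obtain ⟨hmU, hmf, hmx⟩ : m ∈ U ∧ f m = f x ∧ x < m := by simpa using hm.1
      have hmem : (x, m) ∈ F := by
        rw [hF]
        refine Or.inr ⟨hTU x hx, hmU, hmf.symm, hmx, fun z hz hfz hxz => ?_⟩
        rcases hcomp m hmU z hz (hmf.trans hfz.symm) with h | h
        · exact h
        · exact hm.2 (by simpa using ⟨hz, hfz, hxz⟩) h
      simp only [hT, Finset.mem_sdiff, Finset.mem_univ, true_and, Finset.mem_image, not_exists,
        not_and] at hx
      exact hx (x, m) hmem rfl
    have hTk : T.card ≤ k := by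
      rw [← Finset.card_range k]
      refine Finset.card_le_card_of_injOn f ?_ ?_
      · intro x hx
        obtain ⟨i, hi, -⟩ := hf x (hTU x hx)
        simp [hi]
      · intro x hx y hy hxy
        rcases hcomp x (hTU x hx) y (hTU y hy) hxy with h | h
        · exact h.eq_of_not_lt (hTmax x hx y (hTU y hy) hxy.symm)
        · exact (h.eq_of_not_lt (hTmax y hy x (hTU x hx) hxy)).symm
    have h₁ : T.card + (F.image Prod.fst).card = Fintype.card P := by
      rw [hT, Finset.card_sdiff_add_card_eq_card (Finset.subset_univ _), Finset.card_univ]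
    have h₂ : (F.image Prod.fst).card ≤ F.card := Finset.card_image_le
    rw [Nat.card_eq_fintype_card]
    change _ ≤ F.card + k
    omega
  · rw [← loopCount_add_ncard hmatch]
    congr 2
    ext x
    have := hloop x
    simp only [Set.mem_ofPred_eq, Finset.mem_val]
    tauto

/-- The chains are the paths of non-loop edges starting at the elements that are no upper end, of
which there are at most k. Descending along edges from any non-loop element reaches such a start. -/
theorem exists_chains_of_admissible [Finite P] {S : Set P} {k : ℕ} {M : Multiset (P × P)}
    (hM : Admissible S M) (hk : Nat.card P ≤ M.card + k) :
    ∃ C : Fin k → Set P, (∀ i, IsChain (· ≤ ·) (C i) ∧ C i ⊆ S) ∧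
      loopCount M + (⋃ i, C i).ncard = Nat.card P := by
  classical
  have := Fintype.ofFinite P
  let R : P → P → Prop := fun x y => (x, y) ∈ M ∧ x ≠ y
  have hR : Relator.RightUnique R := fun x y z h₁ h₂ => hM.isMatching.snd_eq h₁.1 h₂.1
  have hRlt : ∀ {x y}, R x y → x < y := fun h => lt_of_le_of_ne (hM.le _ h.1) h.2
  have hle : ∀ {x y}, Relation.ReflTransGen R x y → x ≤ y := by
    intro x y h
    induction h with
    | refl => exact le_rfl
    | tail _ h ih => exact ih.trans (hRlt h).le
  set T : Finset P := Finset.univ \ (M.map Prod.snd).toFinset with hT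
  have hTcard : T.card ≤ k := by
    have h₁ : T.card + (M.map Prod.snd).toFinset.card = Fintype.card P := by
      rw [hT, Finset.card_sdiff_add_card_eq_card (Finset.subset_univ _), Finset.card_univ]
    rw [Multiset.toFinset_card_of_nodup hM.isMatching.2, Multiset.card_map] at h₁
    rw [Nat.card_eq_fintype_card] at hk
    omega
  have hTmem : ∀ z, z ∈ T ↔ ∀ x, (x, z) ∉ M := by
    intro z
    simp [hT]
  obtain ⟨f, hf⟩ : ∃ f : T → Fin k, Function.Injective f :=
    ⟨_, (Fin.castLE_injective hTcard).comp T.equivFin.injective⟩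
  have hnl : ∀ z ∈ T, ∀ x, Relation.ReflTransGen R z x → (x, x) ∉ M := by
    intro z hz x hzx
    rcases Relation.ReflTransGen.cases_tail hzx with rfl | ⟨w, -, hw⟩
    · exact (hTmem _).1 hz _
    · exact fun hx => hw.2 (hM.isMatching.fst_eq hw.1 hx)
  refine ⟨fun i => {x | ∃ z : T, f z = i ∧ Relation.ReflTransGen R z x}, fun i => ⟨?_, ?_⟩, ?_⟩
  · rintro x ⟨z, hz, hx⟩ y ⟨z', hz', hy⟩ -
    obtain rfl : z = z' := hf (hz.trans hz'.symm)
    rcases Relation.ReflTransGen.total_of_right_unique hR hx hy with h | h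
    exacts [Or.inl (hle h), Or.inr (hle h)]
  · rintro x ⟨z, -, hx⟩
    by_contra hxS
    exact hnl z z.2 x hx (hM.loop_mem x hxS)
  · rw [← loopCount_add_ncard hM.isMatching]
    congr 2
    ext x
    simp only [Set.mem_iUnion, Set.mem_ofPred_eq]
    constructor
    · rintro ⟨i, z, -, hx⟩
      exact hnl z z.2 x hx
    · intro hx
      suffices h : ∃ z ∈ T, Relation.ReflTransGen R z x by
        obtain ⟨z, hz, h⟩ := h
        exact ⟨f ⟨z, hz⟩, ⟨z, hz⟩, rfl, h⟩
      induction x using WellFoundedLT.induction with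
      | _ x ih =>
      by_cases hxT : x ∈ T
      · exact ⟨x, hxT, .refl⟩
      · obtain ⟨w, hw⟩ : ∃ w, (w, x) ∈ M := by simpa [hTmem] using hxT
        have hwx : R w x := ⟨hw, fun h => hx (h ▸ hw)⟩
        obtain ⟨z, hz, hzw⟩ := ih w (hRlt hwx) fun h => hwx.2 (hM.isMatching.snd_eq h hw)
        exact ⟨z, hz, hzw.tail hwx⟩

/-- Together with `exists_admissible`: |P| - c_k(S) is the least number of loops of an admissible
matching with at least |P| - k edges. -/
theorem card_le_loopCount_add_maxChainUnion [Finite P] {S : Set P} {k : ℕ} {M : Multiset (P × P)}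
    (hM : Admissible S M) (hk : Nat.card P ≤ M.card + k) :
    Nat.card P ≤ loopCount M + maxChainUnion S k := by
  obtain ⟨C, hC, h⟩ := exists_chains_of_admissible hM hk
  have := ncard_le_maxChainUnion hC
  omega

theorem exists_admissible [Finite P] (S : Set P) (k : ℕ) :
    ∃ M, Admissible S M ∧ Nat.card P ≤ M.card + k ∧
      loopCount M + maxChainUnion S k = Nat.card P := by
  obtain ⟨C, hC, h⟩ := exists_chains S k
  rw [← h]
  exact exists_admissible_of_chains hC

/-- A loop forced in both matchings has multiplicity two in the sum, and a matching holds it at most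
once, so both new matchings keep it. -/
theorem Admissible.of_add_eq {S : Set P} {M M' N N' : Multiset (P × P)} (hM : Admissible S M)
    (hM' : Admissible S M') (hN : IsMatching N) (hN' : IsMatching N') (h : N + N' = M + M') :
    Admissible S N ∧ Admissible S N' := by
  have hle : ∀ e ∈ N + N', e.1 ≤ e.2 := by
    intro e he
    rw [h, Multiset.mem_add] at he
    exact he.elim (hM.le e) (hM'.le e)
  exact ⟨⟨hN, fun e he => hle e (Multiset.mem_add.2 (Or.inl he)), fun p hp =>
      (hN.mem_of_add_eq hN' h (hM.loop_mem p hp) (hM'.loop_mem p hp)).1⟩,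
    ⟨hN', fun e he => hle e (Multiset.mem_add.2 (Or.inr he)), fun p hp =>
      (hN.mem_of_add_eq hN' h (hM.loop_mem p hp) (hM'.loop_mem p hp)).2⟩⟩

theorem Admissible.mono {S T : Set P} {M : Multiset (P × P)} (hST : S ⊆ T) (hM : Admissible S M) :
    Admissible T M :=
  ⟨hM.isMatching, hM.le, fun p hp => hM.loop_mem p fun h => hp (hST h)⟩

/-- The sequence `c_k(S)` is concave. -/
theorem maxChainUnion_concave [Finite P] (S : Set P) (k : ℕ) :
    maxChainUnion S (k + 2) + maxChainUnion S k ≤ 2 * maxChainUnion S (k + 1) := by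
  obtain ⟨M, hM, hc, hl⟩ := exists_admissible S (k + 2)
  obtain ⟨M', hM', hc', hl'⟩ := exists_admissible S k
  suffices h : ∃ N N', Admissible S N ∧ Admissible S N' ∧ Nat.card P ≤ N.card + (k + 1) ∧
      Nat.card P ≤ N'.card + (k + 1) ∧ loopCount N + loopCount N' = loopCount M + loopCount M' by
    obtain ⟨N, N', hN, hN', hNc, hNc', hs⟩ := h
    have := card_le_loopCount_add_maxChainUnion hN hNc
    have := card_le_loopCount_add_maxChainUnion hN' hNc'
    omega
  -- Otherwise `M` has exactly |P| - k - 2 edges, at least two fewer than `M'`, and moving one edge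
  -- makes both large enough.
  by_cases hlt : Nat.card P ≤ M.card + (k + 1)
  · exact ⟨M, M', hM, hM', hlt, by omega, rfl⟩
  · obtain ⟨N, N', hN, hN', hs, hNc⟩ := exists_rebalanced_matchings M M' hM.isMatching
      hM'.isMatching (by omega)
    obtain ⟨h₁, h₂⟩ := hM.of_add_eq hM' hN hN' hs
    have hcard := congrArg Multiset.card hs
    simp only [Multiset.card_add] at hcard
    exact ⟨N, N', h₁, h₂, by omega, by omega, by rw [← loopCount_add, hs, loopCount_add]⟩

end Chains

/-! ### Rows, columns and the Legendre transform of c_k -/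

section Rows

variable {P : Type u} [PartialOrder P]

/-- The number of boxes of the shape in the columns from the `t`-th one on. -/
noncomputable def boxesFrom (S : Set P) (t : ℕ) : ℕ :=
  ∑ i ∈ Finset.range (Nat.card P), (rowLength S i - t)

/-- The length of the `t`-th column of the shape. -/
noncomputable def colLength (S : Set P) (t : ℕ) : ℕ :=
  ((Finset.range (Nat.card P)).filter fun i => t < rowLength S i).card

theorem boxesFrom_eq_add (S : Set P) (t : ℕ) :
    boxesFrom S t = boxesFrom S (t + 1) + colLength S t := by
  rw [boxesFrom, boxesFrom, colLength, Finset.card_filter, ← Finset.sum_add_distrib]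
  refine Finset.sum_congr rfl fun i _ => ?_
  split_ifs <;> omega

variable [Finite P]

theorem maxChainUnion_mono (S : Set P) : Monotone (maxChainUnion S) := by
  intro k l hkl
  obtain ⟨M, hM, hc, hl⟩ := exists_admissible S k
  have := card_le_loopCount_add_maxChainUnion hM (hc.trans (by omega : _ ≤ M.card + l))
  omega

theorem maxChainUnion_le_ncard (S : Set P) (k : ℕ) : maxChainUnion S k ≤ S.ncard := by
  obtain ⟨C, hC, h⟩ := exists_chains S k
  rw [← h]
  exact Set.ncard_le_ncard (Set.iUnion_subset fun i => (hC i).2)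

theorem maxChainUnion_zero (S : Set P) : maxChainUnion S 0 = 0 := by
  obtain ⟨C, -, h⟩ := exists_chains S 0
  rw [← h]
  simp

theorem maxChainUnion_of_card_le (S : Set P) {k : ℕ} (hk : Nat.card P ≤ k) :
    maxChainUnion S k = S.ncard := by
  refine le_antisymm (maxChainUnion_le_ncard S k) (le_trans ?_ (maxChainUnion_mono S hk))
  let e := Finite.equivFin P
  have h := ncard_le_maxChainUnion (S := S) (C := fun i => {x | x ∈ S ∧ e x = i}) fun i =>
    ⟨fun x hx y hy hne => absurd (e.injective (hx.2.trans hy.2.symm)) hne, fun x hx => hx.1⟩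
  refine le_of_eq_of_le (congrArg Set.ncard ?_) h
  ext x
  simp

theorem rowLength_antitone (S : Set P) : Antitone (rowLength S) := by
  refine antitone_nat_of_succ_le fun k => ?_
  have h := maxChainUnion_concave S k
  have h₁ := maxChainUnion_mono S (Nat.le_add_right k 1)
  have h₂ := maxChainUnion_mono S (Nat.le_add_right (k + 1) 1)
  simp only [rowLength, add_assoc, Nat.reduceAdd] at *
  omega

theorem rowLength_of_card_le (S : Set P) {i : ℕ} (hi : Nat.card P ≤ i) : rowLength S i = 0 := by
  rw [rowLength, maxChainUnion_of_card_le S hi, maxChainUnion_of_card_le S (hi.trans (by omega)),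
    Nat.sub_self]

theorem sum_rowLength (S : Set P) (k : ℕ) :
    ∑ i ∈ Finset.range k, rowLength S i = maxChainUnion S k := by
  have := Finset.sum_range_tsub (maxChainUnion_mono S) k
  rw [maxChainUnion_zero, Nat.sub_zero] at this
  exact this

theorem mem_shape_iff (S : Set P) (i t : ℕ) : (i, t) ∈ shape S ↔ i < colLength S t := by
  have hr := rowLength_antitone S
  change t < rowLength S i ↔ _
  constructor
  · intro h
    rw [← Nat.succ_le_iff, ← Finset.card_range i.succ]
    refine Finset.card_le_card fun j hj => ?_
    have hj' : t < rowLength S j := h.trans_le (hr (by simpa [Nat.lt_succ_iff] using hj))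
    simp only [Finset.mem_filter, Finset.mem_range]
    refine ⟨?_, hj'⟩
    by_contra hc
    rw [rowLength_of_card_le S (by omega)] at hj'
    omega
  · intro h
    by_contra hc
    refine absurd h (not_lt.2 ?_)
    rw [← Finset.card_range i]
    refine Finset.card_le_card fun j hj => ?_
    simp only [Finset.mem_filter, Finset.mem_range] at hj ⊢
    by_contra hij
    have := hr (not_lt.1 hij)
    omega

theorem boxesFrom_zero (S : Set P) : boxesFrom S 0 = S.ncard := by
  simp only [boxesFrom, Nat.sub_zero]
  rw [sum_rowLength, maxChainUnion_of_card_le S le_rfl]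

theorem rowLength_le_card (S : Set P) (i : ℕ) : rowLength S i ≤ Nat.card P := by
  have h := maxChainUnion_le_ncard S (i + 1)
  have h' := Set.ncard_le_ncard (Set.subset_univ S)
  rw [Set.ncard_univ] at h'
  rw [rowLength]
  omega

theorem boxesFrom_card (S : Set P) : boxesFrom S (Nat.card P) = 0 :=
  Finset.sum_eq_zero fun i _ => Nat.sub_eq_zero_of_le (rowLength_le_card S i)

theorem maxChainUnion_le_boxesFrom_add (S : Set P) (t k : ℕ) :
    maxChainUnion S k ≤ boxesFrom S t + t * k := by
  have h₁ : ∑ i ∈ Finset.range k, (rowLength S i - t) ≤ boxesFrom S t := by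
    refine (Finset.sum_le_sum_of_ne_zero fun i _ hi => ?_)
    rw [Finset.mem_range]
    by_contra hc
    rw [rowLength_of_card_le S (by omega)] at hi
    omega
  calc maxChainUnion S k = ∑ i ∈ Finset.range k, rowLength S i := (sum_rowLength S k).symm
    _ ≤ ∑ i ∈ Finset.range k, ((rowLength S i - t) + t) :=
      Finset.sum_le_sum fun i _ => by omega
    _ = ∑ i ∈ Finset.range k, (rowLength S i - t) + t * k := by
      rw [Finset.sum_add_distrib, Finset.sum_const, Finset.card_range, smul_eq_mul, mul_comm]
    _ ≤ _ := by omega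

/-- The bound c_k - t k ≤ `boxesFrom S t` is attained when k counts precisely the rows longer than
t. -/
theorem boxesFrom_add_eq_maxChainUnion (S : Set P) (t : ℕ) :
    boxesFrom S t + t * colLength S t = maxChainUnion S (colLength S t) := by
  have hmem : ∀ i, t < rowLength S i ↔ i < colLength S t := fun i => mem_shape_iff S i t
  have h₁ : boxesFrom S t = ∑ i ∈ Finset.range (colLength S t), (rowLength S i - t) := by
    symm
    refine Finset.sum_subset (fun i hi => ?_) fun i _ hi => ?_
    · rw [Finset.mem_range, ← hmem] at hi
      rw [Finset.mem_range]
      by_contra hc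
      rw [rowLength_of_card_le S (by omega)] at hi
      omega
    · rw [Finset.mem_range, ← hmem] at hi
      omega
  have h₂ : t * colLength S t = ∑ i ∈ Finset.range (colLength S t), t := by
    rw [Finset.sum_const, Finset.card_range, smul_eq_mul, mul_comm]
  rw [← sum_rowLength, h₁, h₂, ← Finset.sum_add_distrib]
  refine Finset.sum_congr rfl fun i hi => ?_
  rw [Finset.mem_range, ← hmem] at hi
  omega

/-- With `exists_admissible_boxesFrom`, this makes `boxesFrom S t` the maximum over admissible M of
(covered elements) - t (chains), where M has |P| - |M| chains. The form avoids truncated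
subtraction. -/
theorem Admissible.le_boxesFrom {S : Set P} {M : Multiset (P × P)} (hM : Admissible S M) (t : ℕ) :
    Nat.card P + t * M.card ≤ loopCount M + boxesFrom S t + t * Nat.card P := by
  obtain ⟨k, hk⟩ := Nat.exists_eq_add_of_le hM.isMatching.card_le
  have h₁ := card_le_loopCount_add_maxChainUnion hM hk.le
  have h₂ := maxChainUnion_le_boxesFrom_add S t k
  have h₃ := congrArg (t * ·) hk
  simp only [mul_add] at h₃
  omega

theorem exists_admissible_boxesFrom (S : Set P) (t : ℕ) :
    ∃ M, Admissible S M ∧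
      loopCount M + boxesFrom S t + t * Nat.card P ≤ Nat.card P + t * M.card := by
  obtain ⟨M, hM, h₁, h₂⟩ := exists_admissible S (colLength S t)
  rw [← boxesFrom_add_eq_maxChainUnion] at h₂
  have h₃ := Nat.mul_le_mul_left t h₁
  rw [mul_add] at h₃
  exact ⟨M, hM, by omega⟩

theorem boxesFrom_mono {S T : Set P} (h : S ⊆ T) (t : ℕ) : boxesFrom S t ≤ boxesFrom T t := by
  obtain ⟨M, hM, h₁⟩ := exists_admissible_boxesFrom S t
  have h₂ := (hM.mono h).le_boxesFrom t
  omega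

theorem maxChainUnion_le_diff_singleton_add_one (S : Set P) (p : P) (k : ℕ) :
    maxChainUnion S k ≤ maxChainUnion (S \ {p}) k + 1 := by
  obtain ⟨C, hC, h⟩ := exists_chains S k
  have h₁ := ncard_le_maxChainUnion (S := S \ {p}) (C := fun i => C i \ {p}) fun i =>
    ⟨(hC i).1.mono Set.sdiff_subset, Set.sdiff_subset_sdiff_left (hC i).2⟩
  have h₂ : ⋃ i, C i \ {p} = (⋃ i, C i) \ {p} := (Set.iUnion_sdiff _ _).symm
  rw [h₂] at h₁
  have h₃ := Set.ncard_le_ncard_sdiff_add_ncard (⋃ i, C i) {p}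
  rw [Set.ncard_singleton] at h₃
  omega

theorem boxesFrom_le_diff_singleton_add_one (S : Set P) (p : P) (t : ℕ) :
    boxesFrom S t ≤ boxesFrom (S \ {p}) t + 1 := by
  have h₁ := boxesFrom_add_eq_maxChainUnion S t
  have h₂ := maxChainUnion_le_diff_singleton_add_one S p (colLength S t)
  have h₃ := maxChainUnion_le_boxesFrom_add (S \ {p}) t (colLength S t)
  omega

end Rows

/-! ### Exchange inequalities for extremal elements -/

section Extremal

variable {P : Type u} [PartialOrder P]

theorem Admissible.diff_singleton {S : Set P} {M : Multiset (P × P)} {p : P} (hM : Admissible S M)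
    (hp : (p, p) ∈ M) : Admissible (S \ {p}) M := by
  refine ⟨hM.isMatching, hM.le, fun q hq => ?_⟩
  by_cases hqp : q = p
  · rwa [hqp]
  · exact hM.loop_mem q fun h => hq ⟨h, hqp⟩

/-- The only possible edge with a maximal lower end is its loop, so the lower ends alone tell
whether a maximal element is covered. -/
theorem Admissible.mem_fst_iff {S : Set P} {M : Multiset (P × P)} {p : P} (hM : Admissible S M)
    (hp : IsMax p) : p ∈ M.map Prod.fst ↔ (p, p) ∈ M := by
  constructor
  · intro h
    obtain ⟨⟨x, y⟩, he, rfl⟩ := Multiset.mem_map.1 h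
    have hxy : x ≤ y := hM.le _ he
    rwa [← hp.eq_of_le hxy] at he
  · exact fun h => Multiset.mem_map.2 ⟨_, h, rfl⟩

theorem Admissible.mem_snd_iff {S : Set P} {M : Multiset (P × P)} {p : P} (hM : Admissible S M)
    (hp : IsMin p) : p ∈ M.map Prod.snd ↔ (p, p) ∈ M := by
  constructor
  · intro h
    obtain ⟨⟨x, y⟩, he, rfl⟩ := Multiset.mem_map.1 h
    have hxy : x ≤ y := hM.le _ he
    rwa [hp.eq_of_le hxy] at he
  · exact fun h => Multiset.mem_map.2 ⟨_, h, rfl⟩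

/-- Two families of chains can be recombined so that a maximal element `p` covered by the first
one only changes sides. At most one further minimal element changes sides, and if one does, then
the first family loses a chain to the second one. -/
theorem Admissible.exchange {S : Set P} {M M' : Multiset (P × P)} {p : P} (hM : Admissible S M)
    (hM' : Admissible S M') (hp : IsMax p) (hpM : (p, p) ∉ M) (hpM' : (p, p) ∈ M') :
    ∃ N N', Admissible S N ∧ Admissible S N' ∧ (p, p) ∈ N ∧ (p, p) ∉ N' ∧
      loopCount N + loopCount N' = loopCount M + loopCount M' ∧
      N.card + N'.card = M.card + M'.card ∧ M.card ≤ N.card ∧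
      (∀ q, IsMax q → q ≠ p → (q, q) ∉ M → (q, q) ∈ M' → (q, q) ∉ N ∧ (q, q) ∈ N') ∧
      (∀ q, IsMin q → (q, q) ∉ M → (q, q) ∈ M' →
        (q, q) ∉ N ∧ (q, q) ∈ N' ∨ (q, q) ∈ N ∧ (q, q) ∉ N' ∧ M.card + 1 ≤ N.card) ∧
      (∀ q, IsMin q → (q, q) ∈ M → (q, q) ∉ M' → (q, q) ∈ N ∧ (q, q) ∉ N') := by
  obtain ⟨N, N', hN, hN', hs, hpN, hpN', h⟩ := exists_exchange M M' hM.isMatching hM'.isMatching p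
    ((hM'.mem_fst_iff hp).2 hpM') (fun h => hpM ((hM.mem_fst_iff hp).1 h))
  obtain ⟨hN, hN'⟩ := hM.of_add_eq hM' hN hN' hs
  have hcard := congrArg Multiset.card hs
  simp only [Multiset.card_add] at hcard
  refine ⟨N, N', hN, hN', (hN.mem_fst_iff hp).1 hpN, fun h => hpN' ((hN'.mem_fst_iff hp).2 h),
    by rw [← loopCount_add, hs, loopCount_add], hcard, ?_, ?_, ?_, ?_⟩
  · rcases h with ⟨w, h, -⟩ | ⟨v, -, -, h, -⟩ <;> have := congrArg Multiset.card h <;>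
      simp only [Multiset.card_map, Multiset.card_cons] at this <;> omega
  · intro q hq hqp hqM hqM'
    rw [← hM.mem_fst_iff hq] at hqM
    rw [← hM'.mem_fst_iff hq] at hqM'
    rw [← hN.mem_fst_iff hq, ← hN'.mem_fst_iff hq]
    rcases h with ⟨w, h₁, h₂, -⟩ | ⟨v, h₁, h₂, -⟩
    · rw [h₁]
      rw [← h₂] at hqM'
      simp only [Multiset.mem_cons, hqp, false_or] at hqM' ⊢
      exact ⟨hqM, hqM'⟩
    · constructor
      · intro h
        have := Multiset.mem_cons_of_mem (b := v) h
        rw [h₁] at this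
        simp only [Multiset.mem_cons, hqp, false_or] at this
        exact hqM this
      · have := Multiset.mem_cons_of_mem (b := v) hqM'
        rw [← h₂] at this
        simpa only [Multiset.mem_cons, hqp, false_or] using this
  · intro q hq hqM hqM'
    rw [← hM.mem_snd_iff hq] at hqM
    rw [← hM'.mem_snd_iff hq] at hqM'
    rw [← hN.mem_snd_iff hq, ← hN'.mem_snd_iff hq]
    rcases h with ⟨w, -, -, h₁, h₂⟩ | ⟨v, -, -, h₁, h₂⟩
    · have hnd := hM'.isMatching.2
      have hc := congrArg Multiset.card h₁
      simp only [Multiset.card_map, Multiset.card_cons] at hc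
      rw [← h₂] at hqM' hnd
      rw [h₁]
      -- The path ends at the upper copy of `w`; only this minimal element can change sides, and
      -- then `N` has gained an edge.
      by_cases hqw : q = w
      · subst hqw
        exact Or.inr ⟨Multiset.mem_cons_self _ _, (Multiset.nodup_cons.1 hnd).1, hc.ge⟩
      · simp only [Multiset.mem_cons, hqw, false_or] at hqM' ⊢
        exact Or.inl ⟨hqM, hqM'⟩
    · rw [h₁, h₂]
      exact Or.inl ⟨hqM, hqM'⟩
  · intro q hq hqM hqM'
    rw [← hM.mem_snd_iff hq] at hqM
    rw [← hM'.mem_snd_iff hq] at hqM'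
    rw [← hN.mem_snd_iff hq, ← hN'.mem_snd_iff hq]
    rcases h with ⟨w, -, -, h₁, h₂⟩ | ⟨v, -, -, h₁, h₂⟩
    · rw [← h₂, Multiset.mem_cons, not_or] at hqM'
      rw [h₁]
      exact ⟨Multiset.mem_cons_of_mem hqM, hqM'.2⟩
    · rw [h₁, h₂]
      exact ⟨hqM, hqM'⟩

variable [Finite P]

/-- The loss caused by p weakly decreases in t: the exchange does not shrink the first matching,
whose edges weigh t + 1 instead of t. -/
theorem boxesFrom_succ_add_le (S : Set P) {p : P} (hp : IsMax p) (t : ℕ) :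
    boxesFrom S (t + 1) + boxesFrom (S \ {p}) t ≤ boxesFrom S t + boxesFrom (S \ {p}) (t + 1) := by
  obtain ⟨M, hM, hw⟩ := exists_admissible_boxesFrom S (t + 1)
  obtain ⟨M', hM', hw'⟩ := exists_admissible_boxesFrom (S \ {p}) t
  by_cases hpM : (p, p) ∈ M
  · have h₁ := (hM.diff_singleton hpM).le_boxesFrom (t + 1)
    have h₂ := boxesFrom_mono (Set.sdiff_subset (s := S) (t := {p})) t
    omega
  · obtain ⟨N, N', hN, hN', hpN, -, hl, hc, hle, -⟩ :=
      hM.exchange (hM'.mono Set.sdiff_subset) hp hpM (hM'.loop_mem p (by simp))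
    have h₁ := (hN.diff_singleton hpN).le_boxesFrom (t + 1)
    have h₂ := hN'.le_boxesFrom t
    have h₃ := congrArg (t * ·) hc
    simp only [add_mul, mul_add, one_mul] at *
    omega

/-- Submodularity: starting from optima for P and P - {p, q}, the exchange moves p and leaves q in
place, so one new matching omits p and the other omits q. -/
theorem boxesFrom_add_le_of_isMax_of_isMax {p q : P} (hpq : p ≠ q) (hp : IsMax p) (hq : IsMax q)
    (t : ℕ) :
    boxesFrom (Set.univ : Set P) t + boxesFrom (Set.univ \ {p, q}) t ≤
      boxesFrom (Set.univ \ {p}) t + boxesFrom (Set.univ \ {q}) t := by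
  obtain ⟨M, hM, hw⟩ := exists_admissible_boxesFrom (Set.univ : Set P) t
  obtain ⟨M', hM', hw'⟩ := exists_admissible_boxesFrom (Set.univ \ {p, q}) t
  by_cases hpM : (p, p) ∈ M
  · have h₁ := (hM.diff_singleton hpM).le_boxesFrom t
    have h₂ : boxesFrom (Set.univ \ {p, q}) t ≤ boxesFrom (Set.univ \ {q}) t :=
      boxesFrom_mono (Set.sdiff_subset_sdiff_right (by simp)) t
    omega
  by_cases hqM : (q, q) ∈ M
  · have h₁ := (hM.diff_singleton hqM).le_boxesFrom t
    have h₂ : boxesFrom (Set.univ \ {p, q}) t ≤ boxesFrom (Set.univ \ {p}) t :=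
      boxesFrom_mono (Set.sdiff_subset_sdiff_right (by simp)) t
    omega
  obtain ⟨N, N', hN, hN', hpN, -, hl, hc, -, hmax, -⟩ :=
    hM.exchange (hM'.mono Set.sdiff_subset) hp hpM (hM'.loop_mem p (by simp))
  have hqN' := (hmax q hq hpq.symm hqM (hM'.loop_mem q (by simp))).2
  have h₁ := (hN.diff_singleton hpN).le_boxesFrom t
  have h₂ := (hN'.diff_singleton hqN').le_boxesFrom t
  have h₃ := congrArg (t * ·) hc
  simp only [mul_add] at h₃
  omega

/-- Supermodularity: starting from optima for P - {q} and P - {p}, the loop at q stays while that at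
p joins it, so one new matching omits both. -/
theorem le_boxesFrom_add_of_isMax_of_isMin {p q : P} (hp : IsMax p) (hq : IsMin q)
    (t : ℕ) :
    boxesFrom (Set.univ \ {p}) t + boxesFrom (Set.univ \ {q}) t ≤
      boxesFrom (Set.univ : Set P) t + boxesFrom (Set.univ \ {p, q}) t := by
  have hpq : (Set.univ : Set P) \ {p, q} = (Set.univ \ {p}) \ {q} := by
    rw [Set.sdiff_sdiff, Set.insert_eq]
  have hqp : (Set.univ : Set P) \ {p, q} = (Set.univ \ {q}) \ {p} := by
    rw [Set.sdiff_sdiff, Set.insert_eq, Set.union_comm]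
  obtain ⟨M, hM, hw⟩ := exists_admissible_boxesFrom (Set.univ \ {q}) t
  obtain ⟨M', hM', hw'⟩ := exists_admissible_boxesFrom (Set.univ \ {p}) t
  by_cases hpM : (p, p) ∈ M
  · have h₁ := (hM.diff_singleton hpM).le_boxesFrom t
    rw [← hqp] at h₁
    have h₂ := boxesFrom_mono (Set.subset_univ (Set.univ \ {p})) t
    omega
  by_cases hqM' : (q, q) ∈ M'
  · have h₁ := (hM'.diff_singleton hqM').le_boxesFrom t
    rw [← hpq] at h₁
    have h₂ := boxesFrom_mono (Set.subset_univ (Set.univ \ {q})) t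
    omega
  obtain ⟨N, N', hN, hN', hpN, -, hl, hc, -, -, -, hmin⟩ :=
    (hM.mono Set.sdiff_subset).exchange (hM'.mono Set.sdiff_subset) hp hpM (hM'.loop_mem p (by simp))
  have hqN := (hmin q hq (hM.loop_mem q (by simp)) hqM').1
  have h₁ := ((hN.diff_singleton hpN).diff_singleton hqN).le_boxesFrom t
  rw [← hpq] at h₁
  have h₂ := hN'.le_boxesFrom t
  have h₃ := congrArg (t * ·) hc
  simp only [mul_add] at h₃
  omega

/-- Either q stays in place, or it moves along with p. In the latter case the matching weighted by t
+ 1 gains an edge, which accounts for the extra 1. -/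
theorem boxesFrom_succ_add_le_of_isMax_of_isMin {p q : P} (hp : IsMax p) (hq : IsMin q)
    (t : ℕ) :
    boxesFrom (Set.univ : Set P) (t + 1) + boxesFrom (Set.univ \ {p, q}) t ≤
        boxesFrom (Set.univ \ {p}) (t + 1) + boxesFrom (Set.univ \ {q}) t ∨
      boxesFrom (Set.univ : Set P) (t + 1) + boxesFrom (Set.univ \ {p, q}) t ≤
        boxesFrom (Set.univ \ {q}) (t + 1) + boxesFrom (Set.univ \ {p}) t ∨
      boxesFrom (Set.univ : Set P) (t + 1) + boxesFrom (Set.univ \ {p, q}) t + 1 ≤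
        boxesFrom (Set.univ \ {p, q}) (t + 1) + boxesFrom (Set.univ : Set P) t := by
  have hpq : (Set.univ : Set P) \ {p, q} = (Set.univ \ {p}) \ {q} := by
    rw [Set.sdiff_sdiff, Set.insert_eq]
  obtain ⟨M, hM, hw⟩ := exists_admissible_boxesFrom (Set.univ : Set P) (t + 1)
  obtain ⟨M', hM', hw'⟩ := exists_admissible_boxesFrom (Set.univ \ {p, q}) t
  by_cases hpM : (p, p) ∈ M
  · have h₁ := (hM.diff_singleton hpM).le_boxesFrom (t + 1)
    have h₂ : boxesFrom (Set.univ \ {p, q}) t ≤ boxesFrom (Set.univ \ {q}) t :=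
      boxesFrom_mono (Set.sdiff_subset_sdiff_right (by simp)) t
    omega
  by_cases hqM : (q, q) ∈ M
  · have h₁ := (hM.diff_singleton hqM).le_boxesFrom (t + 1)
    have h₂ : boxesFrom (Set.univ \ {p, q}) t ≤ boxesFrom (Set.univ \ {p}) t :=
      boxesFrom_mono (Set.sdiff_subset_sdiff_right (by simp)) t
    omega
  obtain ⟨N, N', hN, hN', hpN, -, hl, hc, hle, -, hmin, -⟩ :=
    hM.exchange (hM'.mono Set.sdiff_subset) hp hpM (hM'.loop_mem p (by simp))
  have h₃ := congrArg (t * ·) hc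
  rcases hmin q hq hqM (hM'.loop_mem q (by simp)) with ⟨-, hqN'⟩ | ⟨hqN, -, hlt⟩
  · left
    have h₁ := (hN.diff_singleton hpN).le_boxesFrom (t + 1)
    have h₂ := (hN'.diff_singleton hqN').le_boxesFrom t
    simp only [add_mul, mul_add, one_mul] at *
    omega
  · right; right
    have h₁ := ((hN.diff_singleton hpN).diff_singleton hqN).le_boxesFrom (t + 1)
    rw [← hpq] at h₁
    have h₂ := hN'.le_boxesFrom t
    simp only [add_mul, mul_add, one_mul] at *
    omega

end Extremal

/-! ### Order duality -/

section Dual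

variable {P : Type u} [PartialOrder P]

theorem maxChainUnion_dual (S : Set P) (k : ℕ) :
    maxChainUnion (P := Pᵒᵈ) (OrderDual.ofDual ⁻¹' S) k = maxChainUnion S k := by
  refine congrArg sSup (Set.ext fun m => ⟨?_, ?_⟩)
  · rintro ⟨C, hC, h⟩
    exact ⟨C, fun i => ⟨(hC i).1.symm, (hC i).2⟩, h⟩
  · rintro ⟨C, hC, h⟩
    exact ⟨C, fun i => ⟨(hC i).1.symm, (hC i).2⟩, h⟩

theorem shape_dual (S : Set P) : shape (P := Pᵒᵈ) (OrderDual.ofDual ⁻¹' S) = shape S := by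
  ext b
  change b.2 < _ - _ ↔ b.2 < _ - _
  rw [maxChainUnion_dual, maxChainUnion_dual]

theorem removedBoxes_dual {p q : P} {A B : ℕ × ℕ} :
    RemovedBoxes (OrderDual.toDual p) (OrderDual.toDual q) A B ↔ RemovedBoxes p q A B := by
  have h₁ := shape_dual (Set.univ : Set P)
  have h₂ := shape_dual (Set.univ \ {p})
  have h₃ := shape_dual (Set.univ \ {q})
  have h₄ := shape_dual (Set.univ \ {p, q})
  rw [RemovedBoxes, RemovedBoxes, ← h₁, ← h₂, ← h₃, ← h₄]
  rfl

end Dual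

section RemovedBoxes

variable {P : Type u} [PartialOrder P] {p₁ p₂ : P} {A B : ℕ × ℕ}

theorem RemovedBoxes.ne (h : RemovedBoxes p₁ p₂ A B) : p₁ ≠ p₂ := by
  rintro rfl
  obtain ⟨hA, hB, hne, h₁, h₂, h₃⟩ := h
  rw [Set.pair_eq_singleton, h₁] at h₃
  have : A ∈ shape (Set.univ : Set P) \ {B} := ⟨hA, hne⟩
  rw [h₃] at this
  exact this.2 (by simp)

theorem RemovedBoxes.symm (h : RemovedBoxes p₁ p₂ A B) : RemovedBoxes p₂ p₁ A B := by
  obtain ⟨hA, hB, hne, h₁, h₂, h₃⟩ := h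
  exact ⟨hA, hB, hne, h₂, h₁, by rwa [Set.pair_comm]⟩

end RemovedBoxes

/-! ### Removed boxes and their columns -/

section RemovedBox

variable {P : Type u} [PartialOrder P] [Finite P]

/-- Removing a maximal element removes one box from the shape. -/
theorem exists_shape_diff_singleton_of_isMax {S : Set P} {p : P} (hp : IsMax p) (hpS : p ∈ S) :
    ∃ B ∈ shape S, shape (S \ {p}) = shape S \ {B} := by
  classical
  have hmono : ∀ t, boxesFrom (S \ {p}) t ≤ boxesFrom S t :=
    fun t => boxesFrom_mono Set.sdiff_subset t
  -- The loss is 0 or 1 and stays 0 once it vanishes. The last column with loss 1 is that of the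
  -- removed box.
  have hex : ∃ t, boxesFrom S t = boxesFrom (S \ {p}) t :=
    ⟨Nat.card P, by rw [boxesFrom_card, boxesFrom_card]⟩
  have hfind := Nat.find_spec hex
  have hlt : ∀ t < Nat.find hex, boxesFrom S t = boxesFrom (S \ {p}) t + 1 := by
    intro t ht
    have h₁ := Nat.find_min hex ht
    have h₂ := hmono t
    have h₃ := boxesFrom_le_diff_singleton_add_one S p t
    omega
  have hge : ∀ t, Nat.find hex ≤ t → boxesFrom S t = boxesFrom (S \ {p}) t := by
    intro t ht
    induction t, ht using Nat.le_induction with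
    | base => exact hfind
    | succ t _ ih =>
      have h₁ := boxesFrom_succ_add_le S hp t
      have h₂ := hmono (t + 1)
      omega
  obtain ⟨b, hb⟩ : ∃ b, Nat.find hex = b + 1 := by
    refine Nat.exists_eq_add_one_of_ne_zero fun h => ?_
    rw [h, boxesFrom_zero, boxesFrom_zero] at hfind
    exact (Set.ncard_sdiff_singleton_lt_of_mem hpS).ne' hfind
  rw [hb] at hlt hge
  have hcol : ∀ t, colLength S t = colLength (S \ {p}) t + if t = b then 1 else 0 := by
    intro t
    have h₁ := boxesFrom_eq_add S t
    have h₂ := boxesFrom_eq_add (S \ {p}) t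
    rcases lt_trichotomy t b with h | rfl | h
    · have h₃ := hlt t (by omega)
      have h₄ := hlt (t + 1) (by omega)
      rw [if_neg (by omega)]
      omega
    · have h₃ := hlt t (by omega)
      have h₄ := hge (t + 1) (by omega)
      rw [if_pos rfl]
      omega
    · have h₃ := hge t (by omega)
      have h₄ := hge (t + 1) (by omega)
      rw [if_neg (by omega)]
      omega
  refine ⟨(colLength (S \ {p}) b, b), ?_, ?_⟩
  · rw [mem_shape_iff, hcol, if_pos rfl]
    omega
  · ext ⟨i, t⟩
    rw [Set.mem_sdiff, mem_shape_iff, mem_shape_iff, hcol, Set.mem_singleton_iff, Prod.mk.injEq]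
    by_cases h : t = b
    · subst h
      simp only [if_true, and_true]
      omega
    · simp [h]

/-- Removing an extremal element removes one box from the shape. -/
theorem exists_shape_diff_singleton {S : Set P} {p : P} (hp : IsMax p ∨ IsMin p) (hpS : p ∈ S) :
    ∃ B ∈ shape S, shape (S \ {p}) = shape S \ {B} := by
  rcases hp with hp | hp
  · exact exists_shape_diff_singleton_of_isMax hp hpS
  · obtain ⟨B, hB, h⟩ := exists_shape_diff_singleton_of_isMax (P := Pᵒᵈ)
      (S := OrderDual.ofDual ⁻¹' S) (p := OrderDual.toDual p) hp.toDual hpS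
    have h' : shape (P := Pᵒᵈ) (OrderDual.ofDual ⁻¹' (S \ {p})) =
        shape (P := Pᵒᵈ) (OrderDual.ofDual ⁻¹' S) \ {B} := h
    rw [shape_dual] at hB
    rw [shape_dual, shape_dual] at h'
    exact ⟨B, hB, h'⟩

theorem boxesFrom_of_shape_eq_diff_singleton {S T : Set P} {B : ℕ × ℕ} (hB : B ∈ shape S)
    (h : shape T = shape S \ {B}) (t : ℕ) :
    boxesFrom S t = boxesFrom T t + if t ≤ B.2 then 1 else 0 := by
  obtain ⟨r, b⟩ := B
  have hmem : ∀ i j, j < rowLength T i ↔ j < rowLength S i ∧ ¬ (i = r ∧ j = b) := by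
    intro i j
    have := Set.ext_iff.1 h (i, j)
    rwa [Set.mem_sdiff, Set.mem_singleton_iff, Prod.mk.injEq] at this
  have hB' : b < rowLength S r := hB
  have hr : r < Nat.card P := by
    by_contra hc
    rw [rowLength_of_card_le S (by omega)] at hB'
    omega
  have hrow : ∀ i, rowLength S i - t =
      (rowLength T i - t) + if i = r then (if t ≤ b then 1 else 0) else 0 := by
    intro i
    by_cases hi : i = r
    · subst hi
      have h₁ := hmem i b
      have h₂ := hmem i (rowLength T i)
      have h₃ := hmem i (rowLength S i)
      have h₄ := hmem i (b + 1)
      simp only [if_true]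
      split_ifs <;> omega
    · have h₁ := hmem i (rowLength T i)
      have h₂ := hmem i (rowLength S i)
      rw [if_neg hi]
      omega
  rw [boxesFrom, boxesFrom, Finset.sum_congr rfl fun i _ => hrow i, Finset.sum_add_distrib,
    Finset.sum_ite_eq', if_pos (Finset.mem_range.2 hr)]

theorem existsUnique_removedBoxes {p₁ p₂ : P} (hne : p₁ ≠ p₂) (h₁ : IsMax p₁ ∨ IsMin p₁)
    (h₂ : IsMax p₂ ∨ IsMin p₂) (h : shape (Set.univ \ {p₁}) = shape (Set.univ \ {p₂})) :
    ∃! AB : (ℕ × ℕ) × (ℕ × ℕ), RemovedBoxes p₁ p₂ AB.1 AB.2 := by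
  have hpq : (Set.univ : Set P) \ {p₁, p₂} = (Set.univ \ {p₁}) \ {p₂} := by
    rw [Set.sdiff_sdiff, Set.insert_eq]
  obtain ⟨B, hB, hB'⟩ := exists_shape_diff_singleton h₁ (Set.mem_univ p₁)
  obtain ⟨A, hA, hA'⟩ := exists_shape_diff_singleton (S := Set.univ \ {p₁}) h₂
    ⟨Set.mem_univ p₂, hne.symm⟩
  rw [hB'] at hA hA'
  rw [← hpq, Set.sdiff_sdiff, Set.union_comm, ← Set.insert_eq] at hA'
  refine ⟨(A, B), ⟨hA.1, hB, hA.2, hB', h ▸ hB', hA'⟩, ?_⟩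
  rintro ⟨A₁, B₁⟩ ⟨hA₁, hB₁, hne₁, e₁, -, e₂⟩
  dsimp only at *
  obtain rfl : B₁ = B := by
    by_contra hc
    have : B₁ ∈ shape (Set.univ : Set P) \ {B} := ⟨hB₁, hc⟩
    rw [← hB', e₁] at this
    exact this.2 rfl
  obtain rfl : A₁ = A := by
    by_contra hc
    have : A₁ ∈ shape (Set.univ : Set P) \ {A, B₁} := ⟨hA₁, by simp [hc, hne₁]⟩
    rw [← hA', e₂] at this
    exact this.2 (by simp)
  rfl

variable {p₁ p₂ : P} {A B : ℕ × ℕ}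

theorem RemovedBoxes.boxesFrom_eq (h : RemovedBoxes p₁ p₂ A B) (t : ℕ) :
    boxesFrom (Set.univ : Set P) t =
        boxesFrom (Set.univ \ {p₁}) t + (if t ≤ B.2 then 1 else 0) ∧
      boxesFrom (Set.univ : Set P) t =
        boxesFrom (Set.univ \ {p₂}) t + (if t ≤ B.2 then 1 else 0) ∧
      boxesFrom (Set.univ \ {p₁}) t =
        boxesFrom (Set.univ \ {p₁, p₂}) t + (if t ≤ A.2 then 1 else 0) := by
  obtain ⟨hA, hB, hne, h₁, h₂, h₃⟩ := h
  refine ⟨boxesFrom_of_shape_eq_diff_singleton hB h₁ t,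
    boxesFrom_of_shape_eq_diff_singleton hB h₂ t,
    boxesFrom_of_shape_eq_diff_singleton (h₁ ▸ ⟨hA, hne⟩) ?_ t⟩
  rw [h₃, h₁, Set.sdiff_sdiff, Set.union_comm, ← Set.insert_eq]

/-- At t = B.2 each single removal loses one box, so submodularity makes the double removal lose
two. -/
theorem RemovedBoxes.col_le_of_isMax (h : RemovedBoxes p₁ p₂ A B) (h₁ : IsMax p₁)
    (h₂ : IsMax p₂) : B.2 ≤ A.2 := by
  obtain ⟨e₁, e₂, e₃⟩ := h.boxesFrom_eq B.2
  have := boxesFrom_add_le_of_isMax_of_isMax h.ne h₁ h₂ B.2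
  simp only [le_refl, if_true] at e₁ e₂
  by_contra hc
  rw [if_neg hc] at e₃
  omega

theorem RemovedBoxes.col_eq_or_of_isMax_of_isMin (h : RemovedBoxes p₁ p₂ A B) (h₁ : IsMax p₁)
    (h₂ : IsMin p₂) : A.2 = B.2 ∨ A.2 + 1 = B.2 := by
  have hle : A.2 ≤ B.2 := by
    obtain ⟨e₁, e₂, e₃⟩ := h.boxesFrom_eq A.2
    have := le_boxesFrom_add_of_isMax_of_isMin h₁ h₂ A.2
    simp only [le_refl, if_true] at e₃
    by_contra hc
    rw [if_neg hc] at e₁ e₂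
    omega
  by_contra! hc
  -- If A lay further left than column t = B.2 - 1, only B would count at t and t + 1, and all three
  -- alternatives would fail.
  obtain ⟨t, ht⟩ : ∃ t, B.2 = t + 1 := Nat.exists_eq_add_one_of_ne_zero (by omega)
  obtain ⟨e₁, e₂, e₃⟩ := h.boxesFrom_eq t
  obtain ⟨f₁, f₂, f₃⟩ := h.boxesFrom_eq (t + 1)
  rw [if_pos (by omega)] at e₁ e₂ f₁ f₂
  rw [if_neg (by omega)] at e₃ f₃
  have := boxesFrom_succ_add_le_of_isMax_of_isMin h₁ h₂ t
  omega

theorem RemovedBoxes.col_le_of_isMin (h : RemovedBoxes p₁ p₂ A B) (h₁ : IsMin p₁)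
    (h₂ : IsMin p₂) : B.2 ≤ A.2 :=
  (removedBoxes_dual.2 h).col_le_of_isMax h₁.toDual h₂.toDual

end RemovedBox

/-! ### Certifying shapes by rows and columns -/

section Certificate

variable {P : Type u} [PartialOrder P] [Finite P]

/-- A bijection from `S` to a Young diagram for which the rows come from chains and the columns
from antichains determines the numbers `c_k(S)`. -/
theorem maxChainUnion_eq_card_filter {S : Set P} {ν : YoungDiagram} {φ : P → ℕ × ℕ}
    (hinj : Set.InjOn φ S) (himg : φ '' S = (ν : Set (ℕ × ℕ)))
    (hrow : ∀ x ∈ S, ∀ y ∈ S, (φ x).1 = (φ y).1 → x ≤ y ∨ y ≤ x)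
    (hcol : ∀ x ∈ S, ∀ y ∈ S, x < y → (φ x).2 ≠ (φ y).2) (k : ℕ) :
    maxChainUnion S k = (ν.cells.filter fun d => d.1 < k).card := by
  classical
  have := Fintype.ofFinite P
  apply le_antisymm
  · obtain ⟨C, hC, h⟩ := exists_chains S k
    rw [← h]
    set U := (⋃ i, C i).toFinset with hU
    have hUS : ∀ x ∈ U, x ∈ S := by
      intro x hx
      obtain ⟨i, hi⟩ := Set.mem_iUnion.1 (Set.mem_toFinset.1 hx)
      exact (hC i).2 hi
    have hφ : ∀ x ∈ S, φ x ∈ ν.cells := fun x hx => by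
      have : φ x ∈ (ν : Set (ℕ × ℕ)) := himg ▸ Set.mem_image_of_mem φ hx
      exact this
    rw [Set.ncard_eq_toFinset_card']
    rw [Finset.card_eq_sum_card_fiberwise (f := fun x => (φ x).2) (t := ν.cells.image Prod.snd)
      fun x hx => Finset.mem_image_of_mem _ (hφ x (hUS x hx)),
      Finset.card_eq_sum_card_fiberwise (f := Prod.snd) (t := ν.cells.image Prod.snd)
      fun x hx => Finset.mem_image_of_mem _ (Finset.mem_filter.1 hx).1]
    refine Finset.sum_le_sum fun t _ => ?_
    -- k chains meet an antichain at most k times, which settles columns with at least k boxes. A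
    -- shorter column lies wholly in the first k rows.
    by_cases hfull : ∀ i < k, (i, t) ∈ ν
    · have h₁ : k ≤ ((ν.cells.filter fun d => d.1 < k).filter fun d => d.2 = t).card := by
        rw [← Finset.card_range k]
        refine Finset.card_le_card_of_injOn (fun i => (i, t)) ?_ ?_
        · intro i hi
          have hi' : i < k := by simpa using hi
          simpa [hi'] using hfull i hi'
        · intro i _ j _ hij
          exact congrArg Prod.fst hij
      refine le_trans ?_ h₁
      have hidx : ∀ x : U.filter fun x => (φ x).2 = t, ∃ i : Fin k, x.1 ∈ C i := fun x =>
        Set.mem_iUnion.1 (Set.mem_toFinset.1 (Finset.mem_filter.1 x.2).1)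
      choose f hf using hidx
      have hfi : Function.Injective f := by
        intro x y hxy
        obtain ⟨hx, hxt⟩ := Finset.mem_filter.1 x.2
        obtain ⟨hy, hyt⟩ := Finset.mem_filter.1 y.2
        have hne : ¬ x.1 < y.1 := fun h => hcol _ (hUS _ hx) _ (hUS _ hy) h (hxt.trans hyt.symm)
        have hne' : ¬ y.1 < x.1 := fun h => hcol _ (hUS _ hy) _ (hUS _ hx) h (hyt.trans hxt.symm)
        refine Subtype.ext ?_
        rcases (hC (f x)).1.total (hf x) (hxy ▸ hf y) with h | h
        exacts [h.eq_of_not_lt hne, (h.eq_of_not_lt hne').symm]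
      simpa only [Fintype.card_coe, Fintype.card_fin] using Fintype.card_le_of_injective f hfi
    · push Not at hfull
      obtain ⟨i, hik, hi⟩ := hfull
      refine Finset.card_le_card_of_injOn φ ?_ ?_
      · intro x hx
        have hx' := Finset.mem_filter.1 hx
        have hxν := hφ x (hUS x hx'.1)
        simp only [Finset.coe_filter, Finset.mem_filter, Set.mem_ofPred_eq]
        refine ⟨⟨hxν, ?_⟩, hx'.2⟩
        by_contra hc
        exact hi (ν.isLowerSet (Prod.mk_le_mk.2 ⟨by omega, hx'.2.ge⟩ : (i, t) ≤ φ x) hxν)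
      · exact hinj.mono fun x hx => hUS x (Finset.mem_filter.1 hx).1
  · have h := ncard_le_maxChainUnion (S := S) (k := k)
      (C := fun i => {x | x ∈ S ∧ (φ x).1 = i}) fun i =>
      ⟨fun x hx y hy _ => hrow x hx.1 y hy.1 (hx.2.trans hy.2.symm), fun x hx => hx.1⟩
    refine le_of_eq_of_le ?_ h
    rw [← Set.InjOn.ncard_image (f := φ), ← Set.ncard_coe_finset]
    · congr 1
      ext d
      simp only [Finset.coe_filter, YoungDiagram.mem_cells, Set.mem_ofPred_eq, Set.mem_image,
        Set.mem_iUnion]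
      have hd : d ∈ ν ↔ d ∈ φ '' S := by rw [himg]; rfl
      rw [hd]
      constructor
      · rintro ⟨⟨x, hx, rfl⟩, hlt⟩
        exact ⟨x, ⟨⟨_, hlt⟩, hx, rfl⟩, rfl⟩
      · rintro ⟨x, ⟨i, hx, hi⟩, rfl⟩
        exact ⟨⟨x, hx, rfl⟩, hi ▸ i.2⟩
    · refine hinj.mono fun x hx => ?_
      obtain ⟨i, hi⟩ := Set.mem_iUnion.1 hx
      exact hi.1

/-- Surjectivity onto ν comes from the cardinality bound. -/
theorem shape_eq_of_bijOn {S : Set P} {ν : YoungDiagram} {φ : P → ℕ × ℕ}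
    (hinj : Set.InjOn φ S) (hmaps : ∀ x ∈ S, φ x ∈ ν) (hcard : ν.card ≤ S.ncard)
    (hrow : ∀ x ∈ S, ∀ y ∈ S, (φ x).1 = (φ y).1 → x ≤ y ∨ y ≤ x)
    (hcol : ∀ x ∈ S, ∀ y ∈ S, x < y → (φ x).2 ≠ (φ y).2) :
    shape S = (ν : Set (ℕ × ℕ)) := by
  have himg : φ '' S = (ν : Set (ℕ × ℕ)) := by
    refine Set.eq_of_subset_of_ncard_le (Set.image_subset_iff.2 hmaps) ?_ ν.cells.finite_toSet
    rw [hinj.ncard_image]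
    exact (Set.ncard_coe_finset ν.cells).trans_le hcard
  have hc := maxChainUnion_eq_card_filter hinj himg hrow hcol
  ext ⟨i, j⟩
  change j < rowLength S i ↔ (i, j) ∈ ν
  rw [YoungDiagram.mem_iff_lt_rowLen, YoungDiagram.rowLen_eq_card, rowLength, hc, hc]
  have h : ν.cells.filter (fun d => d.1 < i + 1) =
      (ν.cells.filter fun d => d.1 < i) ∪ ν.row i := by
    ext d
    simp only [Finset.mem_filter, Finset.mem_union, YoungDiagram.row, Nat.lt_succ_iff_lt_or_eq]
    tauto
  rw [h, Finset.card_union_of_disjoint, Nat.add_sub_cancel_left]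
  rw [Finset.disjoint_left]
  intro d hd hd'
  simp only [Finset.mem_filter, YoungDiagram.row] at hd hd'
  omega

end Certificate

/-- The boxes of a Young diagram, ordered so that the rows are chains and the leftmost boxes of
the rows in `T` lie below all other boxes of the rows in `T`. -/
@[ext]
structure TiedRows (μ : YoungDiagram) (T : Set ℕ) where
  row : ℕ
  col : ℕ
  mem : (row, col) ∈ μ

/-! ### The posets of tied rows -/

namespace TiedRows

variable {μ : YoungDiagram} {T : Set ℕ}

instance : PartialOrder (TiedRows μ T) where
  le x y := (x.row = y.row ∧ x.col ≤ y.col) ∨ (x.row ∈ T ∧ y.row ∈ T ∧ x.col = 0 ∧ 0 < y.col)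
  le_refl x := Or.inl ⟨rfl, le_rfl⟩
  le_trans x y z := by
    rintro (⟨h₁, h₂⟩ | ⟨h₁, h₂, h₃, h₄⟩) (⟨k₁, k₂⟩ | ⟨k₁, k₂, k₃, k₄⟩)
    · exact Or.inl ⟨h₁.trans k₁, h₂.trans k₂⟩
    · exact Or.inr ⟨h₁ ▸ k₁, k₂, by omega, k₄⟩
    · exact Or.inr ⟨h₁, k₁ ▸ h₂, h₃, by omega⟩
    · omega
  le_antisymm x y := by
    rintro (⟨h₁, h₂⟩ | ⟨h₁, h₂, h₃, h₄⟩) (⟨k₁, k₂⟩ | ⟨k₁, k₂, k₃, k₄⟩)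
    · exact TiedRows.ext h₁ (le_antisymm h₂ k₂)
    all_goals omega

theorem le_iff {x y : TiedRows μ T} : x ≤ y ↔
    (x.row = y.row ∧ x.col ≤ y.col) ∨ (x.row ∈ T ∧ y.row ∈ T ∧ x.col = 0 ∧ 0 < y.col) := Iff.rfl

/-- The elements of `TiedRows μ T` are the boxes of `μ`. -/
def equivCells : TiedRows μ T ≃ μ.cells where
  toFun x := ⟨(x.row, x.col), x.mem⟩
  invFun c := ⟨c.1.1, c.1.2, c.2⟩
  left_inv _ := rfl
  right_inv _ := rfl

instance : Finite (TiedRows μ T) := Finite.of_equiv _ equivCells.symm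

theorem ncard_univ : (Set.univ : Set (TiedRows μ T)).ncard = μ.card := by
  rw [Set.ncard_univ, Nat.card_congr equivCells, Nat.card_eq_fintype_card, Fintype.card_coe]

/-- Ties only relate column 0 to positive columns, so columns remain antichains. -/
theorem shape_univ : shape (Set.univ : Set (TiedRows μ T)) = (μ : Set (ℕ × ℕ)) := by
  refine shape_eq_of_bijOn (φ := fun x => (x.row, x.col)) ?_ (fun x _ => x.mem) ncard_univ.ge ?_ ?_
  · intro x _ y _ h
    simp only [Prod.mk.injEq] at h
    exact TiedRows.ext h.1 h.2
  · intro x _ y _ h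
    rcases le_total x.col y.col with h' | h'
    exacts [Or.inl (Or.inl ⟨h, h'⟩), Or.inr (Or.inl ⟨h.symm, h'⟩)]
  · rintro x - y - hxy h
    rcases hxy.le with ⟨h₁, -⟩ | h'
    · exact hxy.ne (TiedRows.ext h₁ h)
    · dsimp only at h
      omega

end TiedRows

/-! ### Sharpness: explicit relabellings -/

section Removal

variable {μ : YoungDiagram} {A B : ℕ × ℕ}

theorem rowLen_eq_of_isLowerSet_diff (hB : B ∈ μ)
    (h : IsLowerSet ((μ : Set (ℕ × ℕ)) \ {B})) : μ.rowLen B.1 = B.2 + 1 := by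
  have h₁ := YoungDiagram.mem_iff_lt_rowLen.1 hB
  by_contra hc
  have h₂ : (B.1, B.2 + 1) ∈ μ := YoungDiagram.mem_iff_lt_rowLen.2 (by omega)
  have h₃ : B ∈ (μ : Set (ℕ × ℕ)) \ {B} := h (Prod.mk_le_mk.2 ⟨le_rfl, by omega⟩ :
    B ≤ (B.1, B.2 + 1)) ⟨h₂, fun h => by simpa using congrArg Prod.snd h⟩
  exact h₃.2 rfl

theorem rowLen_eq_of_isLowerSet_diff_pair (hA : A ∈ μ) (hne : (A.1, A.2 + 1) ≠ B)
    (h : IsLowerSet ((μ : Set (ℕ × ℕ)) \ {A, B})) : μ.rowLen A.1 = A.2 + 1 := by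
  have h₁ := YoungDiagram.mem_iff_lt_rowLen.1 hA
  by_contra hc
  have h₂ : (A.1, A.2 + 1) ∈ μ := YoungDiagram.mem_iff_lt_rowLen.2 (by omega)
  have h₃ : A ∈ (μ : Set (ℕ × ℕ)) \ {A, B} := h (Prod.mk_le_mk.2 ⟨le_rfl, by omega⟩ :
    A ≤ (A.1, A.2 + 1)) ⟨h₂, by
      rintro (h | h)
      · simpa using congrArg Prod.snd h
      · exact hne h⟩
  exact h₃.2 (by simp)

/-- `φ` sends the elements outside `Y` to boxes outside `X` in such a way that the rows come from
chains and the columns from antichains. -/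
structure TiedRows.IsRelabelling {T : Set ℕ} (Y : Set (TiedRows μ T)) (X : Finset (ℕ × ℕ))
    (φ : TiedRows μ T → ℕ × ℕ) : Prop where
  mem : ∀ x ∉ Y, φ x ∈ μ
  notMem : ∀ x ∉ Y, φ x ∉ X
  inj : ∀ x ∉ Y, ∀ y ∉ Y, φ x = φ y → x = y
  row : ∀ x ∉ Y, ∀ y ∉ Y, (φ x).1 = (φ y).1 → x ≤ y ∨ y ≤ x
  col : ∀ x ∉ Y, ∀ y ∉ Y, x < y → (φ x).2 ≠ (φ y).2

theorem TiedRows.IsRelabelling.shape_eq {T : Set ℕ} {X : Finset (ℕ × ℕ)} {Y : Set (TiedRows μ T)}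
    {φ : TiedRows μ T → ℕ × ℕ} (hφ : IsRelabelling Y X φ) (hX : X ⊆ μ.cells)
    (h : IsLowerSet ((μ : Set (ℕ × ℕ)) \ X)) (hY : Y.ncard ≤ X.card) :
    shape (Set.univ \ Y) = (μ : Set (ℕ × ℕ)) \ X := by
  have hcells : ((μ.cells \ X : Finset (ℕ × ℕ)) : Set (ℕ × ℕ)) = (μ : Set (ℕ × ℕ)) \ X := by
    rw [Finset.coe_sdiff]
    rfl
  let ν : YoungDiagram := ⟨μ.cells \ X, by rwa [hcells]⟩
  refine Eq.trans (shape_eq_of_bijOn (ν := ν) (φ := φ) ?_ ?_ ?_ ?_ ?_) hcells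
  · exact fun x hx y hy => hφ.inj x hx.2 y hy.2
  · exact fun x hx => Finset.mem_sdiff.2 ⟨hφ.mem x hx.2, hφ.notMem x hx.2⟩
  · have h₁ : ν.card = μ.card - X.card := Finset.card_sdiff_of_subset hX
    have h₂ := Set.ncard_le_ncard_sdiff_add_ncard (Set.univ : Set (TiedRows μ T)) Y
    rw [TiedRows.ncard_univ] at h₂
    omega
  · exact fun x hx y hy => hφ.row x hx.2 y hy.2
  · exact fun x hx y hy => hφ.col x hx.2 y hy.2

theorem TiedRows.removedBoxes {T : Set ℕ} (hA : A ∈ μ) (hB : B ∈ μ) (hAB : A ≠ B)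
    (h₁ : IsLowerSet ((μ : Set (ℕ × ℕ)) \ {B})) (h₂ : IsLowerSet ((μ : Set (ℕ × ℕ)) \ {A, B}))
    {p₁ p₂ : TiedRows μ T} {φ₁ φ₂ φ₁₂ : TiedRows μ T → ℕ × ℕ}
    (hφ₁ : IsRelabelling {p₁} {B} φ₁) (hφ₂ : IsRelabelling {p₂} {B} φ₂)
    (hφ₁₂ : IsRelabelling {p₁, p₂} {A, B} φ₁₂) :
    RemovedBoxes p₁ p₂ A B := by
  have e₁ := hφ₁.shape_eq (by simpa using hB) (by simpa using h₁) (by simp)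
  have e₂ := hφ₂.shape_eq (by simpa using hB) (by simpa using h₁) (by simp)
  have e₁₂ := hφ₁₂.shape_eq (by simp [Finset.insert_subset_iff, hA, hB]) (by simpa using h₂)
    (by rw [Finset.card_pair hAB]; exact (Set.ncard_insert_le _ _).trans (by simp))
  rw [RemovedBoxes, TiedRows.shape_univ]
  exact ⟨hA, hB, hAB, by simpa using e₁, by simpa using e₂, by simpa using e₁₂⟩

theorem TiedRows.isMax_of_rowLen_le {x : TiedRows μ ∅} (hx : μ.rowLen x.row ≤ x.col + 1) :
    IsMax x := by
  intro y hxy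
  have hy := YoungDiagram.mem_iff_lt_rowLen.1 y.mem
  rcases hxy with ⟨h₁, h₂⟩ | ⟨h, -⟩
  · rw [← h₁] at hy
    exact Or.inl ⟨h₁.symm, by omega⟩
  · exact h.elim

theorem TiedRows.isMin_of_col_eq_zero {T : Set ℕ} {x : TiedRows μ T} (hx : x.col = 0) :
    IsMin x := by
  rintro y (⟨h₁, h₂⟩ | ⟨-, -, -, h⟩)
  · exact Or.inl ⟨h₁.symm, by omega⟩
  · omega

/-- The minimal elements are the first boxes of the rows of A and B, tied. One relabelling serves
all three removals: rows are reversed, but the first box of B's row goes to A, continuing A's row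
thanks to the tie. Since B.2 ≤ A.2, the rest of B's row lands strictly left of column A.2. -/
theorem exists_isMin_isMin (hA : A ∈ μ) (hB : B ∈ μ) (hAB : A ≠ B)
    (h₁ : IsLowerSet ((μ : Set (ℕ × ℕ)) \ {B})) (h₂ : IsLowerSet ((μ : Set (ℕ × ℕ)) \ {A, B}))
    (hle : B.2 ≤ A.2) :
    ∃ (T : Set ℕ) (p₁ p₂ : TiedRows μ T), IsMin p₁ ∧ IsMin p₂ ∧ RemovedBoxes p₁ p₂ A B := by
  have hr := rowLen_eq_of_isLowerSet_diff hB h₁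
  have hs : μ.rowLen A.1 = A.2 + 1 := rowLen_eq_of_isLowerSet_diff_pair hA
    (fun h => by have := congrArg Prod.snd h; dsimp only at this; omega) h₂
  obtain ⟨r, b⟩ := B
  obtain ⟨s, a⟩ := A
  dsimp only at *
  have hrs : s ≠ r := by
    rintro rfl
    exact hAB (Prod.ext rfl (by dsimp only; omega))
  have hmem : ∀ i j, (i, j) ∈ μ ↔ j < μ.rowLen i := fun i j => YoungDiagram.mem_iff_lt_rowLen
  let φ : TiedRows μ {s, r} → ℕ × ℕ := fun x =>
    if x.row = r ∧ x.col = 0 then (s, a) else (x.row, μ.rowLen x.row - 1 - x.col)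
  refine ⟨{s, r}, ⟨s, 0, (hmem _ _).2 (by omega)⟩, ⟨r, 0, (hmem _ _).2 (by omega)⟩,
    TiedRows.isMin_of_col_eq_zero rfl, TiedRows.isMin_of_col_eq_zero rfl,
    TiedRows.removedBoxes (φ₁ := φ) (φ₂ := φ) (φ₁₂ := φ) hA hB hAB h₁ h₂
    ⟨?_, ?_, ?_, ?_, ?_⟩ ⟨?_, ?_, ?_, ?_, ?_⟩ ⟨?_, ?_, ?_, ?_, ?_⟩⟩
  all_goals
    simp only [φ, lt_iff_le_not_ge, TiedRows.le_iff, TiedRows.ext_iff,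
      Set.mem_singleton_iff, Set.mem_insert_iff, Finset.mem_singleton, Finset.mem_insert]
    first
    | rintro ⟨i, j, hij⟩ hx ⟨i', j', hij'⟩ hy
      rw [hmem] at hij hij'
      dsimp only at *
      grind
    | rintro ⟨i, j, hij⟩ hx
      rw [hmem] at hij
      dsimp only at *
      grind

/-- The rows of A and B are equally long disjoint chains; p₁ is the top of B's row and p₂ the bottom
of A's. Removing only p₂ shortens A's row, so `φ₂` swaps the two rows. -/
theorem exists_isMax_isMin_of_col_eq (hA : A ∈ μ) (hB : B ∈ μ) (hAB : A ≠ B)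
    (h₁ : IsLowerSet ((μ : Set (ℕ × ℕ)) \ {B})) (h₂ : IsLowerSet ((μ : Set (ℕ × ℕ)) \ {A, B}))
    (hcol : A.2 = B.2) :
    ∃ p₁ p₂ : TiedRows μ ∅, IsMax p₁ ∧ IsMin p₂ ∧ RemovedBoxes p₁ p₂ A B := by
  have hr := rowLen_eq_of_isLowerSet_diff hB h₁
  have hs : μ.rowLen A.1 = A.2 + 1 := rowLen_eq_of_isLowerSet_diff_pair hA
    (fun h => by have := congrArg Prod.snd h; dsimp only at this; omega) h₂
  obtain ⟨r, b⟩ := B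
  obtain ⟨s, a⟩ := A
  dsimp only at *
  subst hcol
  have hrs : s ≠ r := fun h => hAB (by rw [h])
  have hmem : ∀ i j, (i, j) ∈ μ ↔ j < μ.rowLen i := fun i j => YoungDiagram.mem_iff_lt_rowLen
  refine ⟨⟨r, a, hB⟩, ⟨s, 0, (hmem _ _).2 (by omega)⟩, TiedRows.isMax_of_rowLen_le hr.le,
    TiedRows.isMin_of_col_eq_zero rfl, TiedRows.removedBoxes (φ₁ := fun x => (x.row, x.col))
    (φ₂ := fun x => if x.row = s then (r, x.col - 1) else if x.row = r then (s, x.col)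
      else (x.row, x.col))
    (φ₁₂ := fun x => if x.row = s then (s, x.col - 1) else (x.row, x.col)) hA hB hAB h₁ h₂
    ⟨?_, ?_, ?_, ?_, ?_⟩ ⟨?_, ?_, ?_, ?_, ?_⟩ ⟨?_, ?_, ?_, ?_, ?_⟩⟩
  all_goals
    simp only [lt_iff_le_not_ge, TiedRows.le_iff, TiedRows.ext_iff, Set.mem_singleton_iff,
      Set.mem_insert_iff, Finset.mem_singleton, Finset.mem_insert, Set.mem_empty_iff_false]
    first
    | rintro ⟨i, j, hij⟩ hx ⟨i', j', hij'⟩ hy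
      rw [hmem] at hij hij'
      dsimp only at *
      grind
    | rintro ⟨i, j, hij⟩ hx
      rw [hmem] at hij
      dsimp only at *
      grind

/-- Both ends of B's row are removed. If A is in another row, that row is one shorter than B's
originally and one longer afterwards, so `φ₁₂` swaps them; if A is in the same row, a shift
suffices. -/
theorem exists_isMax_isMin_of_col_succ_eq (hA : A ∈ μ) (hB : B ∈ μ) (hAB : A ≠ B)
    (h₁ : IsLowerSet ((μ : Set (ℕ × ℕ)) \ {B})) (h₂ : IsLowerSet ((μ : Set (ℕ × ℕ)) \ {A, B}))
    (hcol : A.2 + 1 = B.2) :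
    ∃ p₁ p₂ : TiedRows μ ∅, IsMax p₁ ∧ IsMin p₂ ∧ RemovedBoxes p₁ p₂ A B := by
  have hr := rowLen_eq_of_isLowerSet_diff hB h₁
  have hs : A.1 ≠ B.1 → μ.rowLen A.1 = A.2 + 1 := fun hne =>
    rowLen_eq_of_isLowerSet_diff_pair hA (fun h => hne (by rw [← h])) h₂
  obtain ⟨r, b⟩ := B
  obtain ⟨s, a⟩ := A
  dsimp only at *
  subst hcol
  have hmem : ∀ i j, (i, j) ∈ μ ↔ j < μ.rowLen i := fun i j => YoungDiagram.mem_iff_lt_rowLen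
  refine ⟨⟨r, a + 1, hB⟩, ⟨r, 0, (hmem _ _).2 (by omega)⟩, TiedRows.isMax_of_rowLen_le hr.le,
    TiedRows.isMin_of_col_eq_zero rfl, TiedRows.removedBoxes (φ₁ := fun x => (x.row, x.col))
    (φ₂ := fun x => if x.row = r then (r, x.col - 1) else (x.row, x.col))
    (φ₁₂ := fun x => if x.row = r then (s, x.col - 1) else if x.row = s then (r, x.col)
      else (x.row, x.col)) hA hB hAB h₁ h₂
    ⟨?_, ?_, ?_, ?_, ?_⟩ ⟨?_, ?_, ?_, ?_, ?_⟩ ⟨?_, ?_, ?_, ?_, ?_⟩⟩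
  all_goals
    simp only [lt_iff_le_not_ge, TiedRows.le_iff, TiedRows.ext_iff, Set.mem_singleton_iff,
      Set.mem_insert_iff, Finset.mem_singleton, Finset.mem_insert, Set.mem_empty_iff_false]
    first
    | rintro ⟨i, j, hij⟩ hx ⟨i', j', hij'⟩ hy
      rw [hmem] at hij hij'
      dsimp only at *
      grind
    | rintro ⟨i, j, hij⟩ hx
      rw [hmem] at hij
      dsimp only at *
      grind

end Removal

end GreeneShape

theorem theorem2p4 :
    (∀ (P : Type u) [PartialOrder P] [Finite P] (p₁ p₂ : P), p₁ ≠ p₂ →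
      (IsMax p₁ ∨ IsMin p₁) → (IsMax p₂ ∨ IsMin p₂) →
      GreeneShape.shape (Set.univ \ {p₁}) = GreeneShape.shape (Set.univ \ {p₂}) →
      (∃! AB : (ℕ × ℕ) × (ℕ × ℕ), GreeneShape.RemovedBoxes p₁ p₂ AB.1 AB.2) ∧
      ∀ A B : ℕ × ℕ, GreeneShape.RemovedBoxes p₁ p₂ A B →
        ((IsMax p₁ ∧ IsMax p₂) ∨ (IsMin p₁ ∧ IsMin p₂) → B.2 ≤ A.2) ∧
        ((IsMax p₁ ∧ IsMin p₂) ∨ (IsMin p₁ ∧ IsMax p₂) → A.2 = B.2 ∨ A.2 + 1 = B.2)) ∧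
    (∀ (μ : YoungDiagram) (A B : ℕ × ℕ), A ∈ μ → B ∈ μ → A ≠ B →
      IsLowerSet ((μ : Set (ℕ × ℕ)) \ {B}) → IsLowerSet ((μ : Set (ℕ × ℕ)) \ {A, B}) →
      (B.2 ≤ A.2 →
        (∃ (P : Type) (_ : PartialOrder P) (_ : Finite P) (p₁ p₂ : P),
          IsMax p₁ ∧ IsMax p₂ ∧ GreeneShape.shape (Set.univ : Set P) = (μ : Set (ℕ × ℕ)) ∧
          GreeneShape.RemovedBoxes p₁ p₂ A B) ∧
        (∃ (P : Type) (_ : PartialOrder P) (_ : Finite P) (p₁ p₂ : P),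
          IsMin p₁ ∧ IsMin p₂ ∧ GreeneShape.shape (Set.univ : Set P) = (μ : Set (ℕ × ℕ)) ∧
          GreeneShape.RemovedBoxes p₁ p₂ A B)) ∧
      (A.2 = B.2 ∨ A.2 + 1 = B.2 →
        ∃ (P : Type) (_ : PartialOrder P) (_ : Finite P) (p₁ p₂ : P),
          IsMax p₁ ∧ IsMin p₂ ∧ GreeneShape.shape (Set.univ : Set P) = (μ : Set (ℕ × ℕ)) ∧
          GreeneShape.RemovedBoxes p₁ p₂ A B)) := by
  refine ⟨fun P _ _ p₁ p₂ hne h₁ h₂ h => ⟨GreeneShape.existsUnique_removedBoxes hne h₁ h₂ h,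
    fun A B hAB => ⟨?_, ?_⟩⟩, fun μ A B hA hB hAB h₁ h₂ => ⟨fun hle => ?_, ?_⟩⟩
  · rintro (⟨h₁, h₂⟩ | ⟨h₁, h₂⟩)
    exacts [hAB.col_le_of_isMax h₁ h₂, hAB.col_le_of_isMin h₁ h₂]
  · rintro (⟨h₁, h₂⟩ | ⟨h₁, h₂⟩)
    exacts [hAB.col_eq_or_of_isMax_of_isMin h₁ h₂, hAB.symm.col_eq_or_of_isMax_of_isMin h₂ h₁]
  · obtain ⟨T, p₁, p₂, hp₁, hp₂, h⟩ := GreeneShape.exists_isMin_isMin hA hB hAB h₁ h₂ hle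
    refine ⟨⟨(GreeneShape.TiedRows μ T)ᵒᵈ, inferInstance, inferInstance, OrderDual.toDual p₁,
      OrderDual.toDual p₂, hp₁.toDual, hp₂.toDual, ?_, GreeneShape.removedBoxes_dual.2 h⟩,
      ⟨GreeneShape.TiedRows μ T, inferInstance, inferInstance, p₁, p₂, hp₁, hp₂,
        GreeneShape.TiedRows.shape_univ, h⟩⟩
    exact (GreeneShape.shape_dual Set.univ).trans GreeneShape.TiedRows.shape_univ
  · rintro (hcol | hcol)
    · obtain ⟨p₁, p₂, hp₁, hp₂, h⟩ :=
        GreeneShape.exists_isMax_isMin_of_col_eq hA hB hAB h₁ h₂ hcol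
      exact ⟨GreeneShape.TiedRows μ ∅, inferInstance, inferInstance, p₁, p₂, hp₁, hp₂,
        GreeneShape.TiedRows.shape_univ, h⟩
    · obtain ⟨p₁, p₂, hp₁, hp₂, h⟩ :=
        GreeneShape.exists_isMax_isMin_of_col_succ_eq hA hB hAB h₁ h₂ hcol
      exact ⟨GreeneShape.TiedRows μ ∅, inferInstance, inferInstance, p₁, p₂, hp₁, hp₂,
        GreeneShape.TiedRows.shape_univ, h⟩
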